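/- **Conventions.** A *tree* is a partially ordered set $(T,\trianglelefteq)$ (of any cardinality, possibly without a root) in which $\{y: y\trianglelefteq x\}$ is linearly ordered for every $x\in T$. A *sub-branch* of $T$ is a convex, linearly ordered subset (possibly empty); a *branch* is a maximal sub-branch; an *initial segment* is a downward closed sub-branch (possibly empty). For an initial segment $A$ let $\mathrm{top}(A)=\{x\in T:(\forall t\in A)\ t\trianglelefteq x\}$, and for $x,y\in T\setminus A$ put $$x\sim^0_A y\iff(\forall t\in A)\,[\,t\trianglelefteq x\leftrightarrow t\trianglelefteq y\,],$$ $$x\sim^1_A y\iff x\sim^0_A y\ \text{ and }\ (\exists z\in T\setminus A)\,[\,z\trianglelefteq x,\ z\trianglelefteq y,\ z\sim^0_A x\,];$$ these are equivalence relations on $T\setminus A$, and $\mathrm{top}(A)/\!\sim^1_A$ denotes the set of $\sim^1_A$-classes of the elements of $\mathrm{top}(A)\setminus A$. The *Hausdorff degree* of a chain $C$ is defined by recursion: $\mathrm{Hdeg}(C)=0$ iff $C$ is finite; for an ordinal $\alpha>0$, $\mathrm{Hdeg}(C)=\alpha$ iff $\mathrm{Hdeg}(C)\ne\beta$ for all $\beta<\alpha$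 and $C=\sum_{i\in I}C_i$ is an ordered sum of convex pieces $C_i$, where $I$ is well ordered or inversely well ordered and each $C_i$ has a Hausdorff degree smaller than $\alpha$. The tree $T$ is *tame* if there are natural numbers $n^*,k^*$ such that (i) $|\mathrm{top}(A)/\!\sim^1_A|\le n^*$ for every initial segment $A$ of $T$; (ii) no branch of $T$ contains a copy of the rational order $\mathbb Q$; (iii) every branch of $T$ has Hausdorff degree at most $k^*$. Let ${}^{\omega>}2$ be the tree of finite $0$-$1$ sequences ordered by being an initial segment; it *embeds* in $T$ if there is an injective $F:{}^{\omega>}2\to T$ such that $\eta$ is an initial segment of $\nu$ iff $F(\eta)\trianglelefteq F(\nu)$. A *monadic formula* is a formula of monadic second-order logic in the language of partial orders (quantification over elements and over arbitrary subsets of $T$). **Lemma 5.4.** Let $T$ be a tame tree. If ${}^{\omega>}2$ does not embed in $T$, then there are a finite sequence $\bar Q$ of subsets of $T$ and a monadic formula $\varphi(x,y,\bar X)$ such that the relation $\{(x,y)\in T\times T: T\models\varphi(x,y,\bar Q)\}$ is a (strict) well ordering of $T$. -/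

import Mathlib

universe u

namespace MonadicTree

/-! ### Trees -/

/-- A partial order is a tree if the elements below any given element are linearly ordered. -/
def IsTree (T : Type u) [PartialOrder T] : Prop :=
  ∀ x : T, IsChain (· ≤ ·) {y : T | y ≤ x}

section

variable {T : Type u} [PartialOrder T]

/-- A sub-branch: a convex, linearly ordered subset (possibly empty). -/
def IsSubBranch (B : Set T) : Prop :=
  B.OrdConnected ∧ IsChain (· ≤ ·) B

/-- A branch: a maximal sub-branch. -/
def IsBranch (B : Set T) : Prop :=
  Maximal IsSubBranch B

/-- An initial segment: a downward closed sub-branch (possibly empty). -/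
def IsInitialSegment (A : Set T) : Prop :=
  IsSubBranch A ∧ IsLowerSet A

/-- `top(A)`: the elements that lie above (or are equal to) all elements of `A`. -/
def top (A : Set T) : Set T :=
  {x | ∀ t ∈ A, t ≤ x}

/-- The relation `∼⁰_A` on `T \ A`: `x` and `y` break `A` in the same place. -/
def Sim0 (A : Set T) (x y : T) : Prop :=
  x ∉ A ∧ y ∉ A ∧ ∀ t ∈ A, t ≤ x ↔ t ≤ y

/-- The relation `∼¹_A` on `T \ A`. -/
def Sim1 (A : Set T) (x y : T) : Prop :=
  Sim0 A x y ∧ ∃ z, z ≤ x ∧ z ≤ y ∧ Sim0 A z x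

/-- The set `top(A) / ∼¹_A` of equivalence classes. As `∼¹_A` lives on `T \ A`, the possible
maximal element of `A` (the only point of `top(A)` that can be in `A`) is left out. -/
def topClasses (A : Set T) : Set (Set T) :=
  (fun x => {y | Sim1 A x y}) '' (top A \ A)

/-- `IsHdeg α C`: the chain `C` (with the order of `T`) has Hausdorff degree exactly `α`.
A presentation `C = ∑_{i ∈ I} C_i` is given by a map `f`, monotone on `C`, to the linear order `I`;
the summand `C_i` is the part of `C` that `f` sends to `i`. -/
def IsHdeg (α : Ordinal.{u}) (C : Set T) : Prop :=
  (∀ β, β < α → ¬ IsHdeg β C) ∧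
    ((α = 0 ∧ C.Finite) ∨
      (0 < α ∧ ∃ (I : Type u) (_ : LinearOrder I) (f : T → I),
        (WellFoundedLT I ∨ WellFoundedGT I) ∧ MonotoneOn f C ∧
          ∀ i : I, ∃ β, ∃ _ : β < α, IsHdeg β {x ∈ C | f x = i}))
termination_by α

end

/-- `T` is tame for `(n, k)`. -/
structure TameFor (T : Type u) [PartialOrder T] (n k : ℕ) : Prop where
  /-- `|top(A) / ∼¹_A| ≤ n` for all initial segments `A`. -/
  card_le : ∀ A : Set T, IsInitialSegment A → (topClasses A).encard ≤ n
  /-- No branch embeds the rationals. -/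
  scattered : ¬ ∃ B : Set T, IsBranch B ∧ Nonempty (ℚ ↪o B)
  /-- All branches have Hausdorff degree at most `k`. -/
  hdeg_le : ∀ B : Set T, IsBranch B → ∃ α : Ordinal.{u}, α ≤ (k : Ordinal.{u}) ∧ IsHdeg α B

/-- `T` is tame. -/
def Tame (T : Type u) [PartialOrder T] : Prop :=
  ∃ n k : ℕ, TameFor T n k

/-- The full binary tree of finite `0`-`1` sequences, ordered by being an initial segment,
embeds into `T`. -/
def EmbedsBinaryTree (T : Type u) [PartialOrder T] : Prop :=
  ∃ F : List Bool → T, Function.Injective F ∧ ∀ s t : List Bool, s <+: t ↔ F s ≤ F t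

/-! ### The monadic language of trees -/

/-- Monadic second-order formulas in the language of partial orders, with free element variables
indexed by `Fin n` and free set variables indexed by `Fin m`. A quantifier binds the variable
with the last index. -/
inductive MFormula : ℕ → ℕ → Type
  | le {n m : ℕ} (i j : Fin n) : MFormula n m
  | eq {n m : ℕ} (i j : Fin n) : MFormula n m
  | mem {n m : ℕ} (i : Fin n) (X : Fin m) : MFormula n m
  | not {n m : ℕ} (φ : MFormula n m) : MFormula n m
  | and {n m : ℕ} (φ ψ : MFormula n m) : MFormula n m
  | exElem {n m : ℕ} (φ : MFormula (n + 1) m) : MFormula n m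
  | exSet {n m : ℕ} (φ : MFormula n (m + 1)) : MFormula n m

/-- Satisfaction of a monadic formula in `T`: element variables range over the elements of `T`,
set variables over all subsets of `T`. -/
def MFormula.Realize {T : Type u} [PartialOrder T] :
    {n m : ℕ} → MFormula n m → (Fin n → T) → (Fin m → Set T) → Prop
  | _, _, .le i j, v, _ => v i ≤ v j
  | _, _, .eq i j, v, _ => v i = v j
  | _, _, .mem i X, v, V => v i ∈ V X
  | _, _, .not φ, v, V => ¬ φ.Realize v V
  | _, _, .and φ ψ, v, V => φ.Realize v V ∧ ψ.Realize v V
  | _, _, .exElem φ, v, V => ∃ x : T, φ.Realize (Fin.snoc (α := fun _ => T) v x) V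
  | _, _, .exSet φ, v, V => ∃ X : Set T, φ.Realize v (Fin.snoc (α := fun _ => Set T) V X)

end MonadicTree

/-! Iterate the derivative that keeps the points with two incomparable surviving points above them.
Without a copy of the binary tree every point is eventually dropped. This gives an ordinal rank,
non-increasing upwards, such that the points above `x` of the rank of `x` form a chain
(`exists_rank`). Now peel the tree: remove from each directed component an initial chain such that
the ranks in every remaining component lie strictly below the rank of some point of the old one.
Ordinals do not descend forever, so each point has a finite depth, and the removed chains form a
tree without infinite paths (`exists_depth`).

Two points share some first chains and then part. Compare them by the cuts they make in the last
shared chain; if the cuts agree, compare the numbers of the components in which they continue, a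
point that does not continue coming last. Tameness bounds these numbers (`IsDepth.exists_num`) and
makes the cuts well orderable: a chain of finite Hausdorff degree is a sum along a well order or its
inverse, cuts are compared by the first piece they do not exhaust, and ties are resolved inside that
piece by recursion on the degree (`exists_cutLt_wellOrder`). A nonempty set has an initial part that
is a single point or shares one chain more (`IsCoding.exists_initial_part`); repeating this must
stop, which yields a minimum.

Only finitely many sets are needed, because colour changes along a chain mark convex pieces: the
parity of the depth recovers the chains, and for each step of the Hausdorff degree one colouring and
one set of directions serve all chains at once. -/

namespace MonadicTree

/-! ### Splitting rank of a tree without a binary subtree -/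

section Rank

variable {T : Type u} [PartialOrder T]

lemma IsTree.total (hT : IsTree T) {x y z : T} (hx : x ≤ z) (hy : y ≤ z) : x ≤ y ∨ y ≤ x :=
  (hT z).total hx hy

/-- A set in which every element has two incomparable elements above it carries an embedding of
the binary tree. -/
lemma embedsBinaryTree_of_splitting (hT : IsTree T) {S : Set T} {r : T} (hr : r ∈ S)
    (hS : ∀ x ∈ S, ∃ y ∈ S, ∃ z ∈ S, x ≤ y ∧ x ≤ z ∧ ¬ y ≤ z ∧ ¬ z ≤ y) :
    EmbedsBinaryTree T := by
  classical
  choose! f hfS g hgS hf hg hfg hgf using hS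
  let step : T → Bool → T := fun x b => if b then f x else g x
  let F : List Bool → T := fun s => s.foldl step r
  have hstep : ∀ x ∈ S, ∀ b, step x b ∈ S ∧ x ≤ step x b := by
    intro x hx b
    cases b
    · exact ⟨hgS x hx, hg x hx⟩
    · exact ⟨hfS x hx, hf x hx⟩
  have hfold : ∀ (t : List Bool), ∀ x ∈ S, t.foldl step x ∈ S ∧ x ≤ t.foldl step x := by
    intro t
    induction t with
    | nil => intro x hx; exact ⟨hx, le_rfl⟩
    | cons b t ih =>
      intro x hx
      obtain ⟨h1, h2⟩ := hstep x hx b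
      obtain ⟨h3, h4⟩ := ih _ h1
      exact ⟨h3, h2.trans h4⟩
  have hlt : ∀ x ∈ S, ∀ b, ¬ step x b ≤ x := by
    intro x hx b h
    cases b
    · exact hgf x hx (h.trans (hf x hx))
    · exact hfg x hx (h.trans (hg x hx))
  have key : ∀ (s t : List Bool), ∀ x ∈ S, s.foldl step x ≤ t.foldl step x → s <+: t := by
    intro s
    induction s with
    | nil => intro t x _ _; exact List.nil_prefix
    | cons a s ih =>
      intro t x hx h
      cases t with
      | nil =>
        exact absurd (((hfold s _ (hstep x hx a).1).2).trans h) (hlt x hx a)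
      | cons b t =>
        -- Different letters lead to the incomparable points `f x` and `g x`, which cannot have a
        -- common upper bound in a tree.
        have hab : a = b := by
          by_contra hne
          have h1 := ((hfold s _ (hstep x hx a).1).2).trans h
          have h2 := (hfold t _ (hstep x hx b).1).2
          have := hT.total h1 h2
          cases a <;> cases b <;> simp_all [step]
        subst hab
        exact List.cons_prefix_cons.2 ⟨rfl, ih t _ (hstep x hx a).1 h⟩
  refine ⟨F, fun s t h => ?_, fun s t => ⟨?_, key s t r hr⟩⟩
  · exact (key s t r hr h.le).eq_of_length_le (key t s r hr h.ge).length_le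
  · rintro ⟨t, rfl⟩
    simpa [F] using (hfold t _ (hfold s r hr).1).2

/-- The iterated splitting derivative. -/
def splitDeriv (α : Ordinal.{u}) : Set T :=
  {x | ∀ β, ∀ _ : β < α, ∃ y ∈ splitDeriv β, ∃ z ∈ splitDeriv β,
    x ≤ y ∧ x ≤ z ∧ ¬ y ≤ z ∧ ¬ z ≤ y}
termination_by α

lemma mem_splitDeriv {α : Ordinal.{u}} {x : T} :
    x ∈ splitDeriv α ↔ ∀ β < α, ∃ y ∈ splitDeriv (T := T) β, ∃ z ∈ splitDeriv β,
      x ≤ y ∧ x ≤ z ∧ ¬ y ≤ z ∧ ¬ z ≤ y := by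
  rw [splitDeriv]; rfl

lemma splitDeriv_anti {α β : Ordinal.{u}} (h : α ≤ β) :
    splitDeriv (T := T) β ⊆ splitDeriv α := by
  intro x hx
  rw [mem_splitDeriv] at hx ⊢
  exact fun γ hγ => hx γ (hγ.trans_le h)

lemma isLowerSet_splitDeriv (α : Ordinal.{u}) : IsLowerSet (splitDeriv (T := T) α) := by
  intro x w hwx hx
  rw [mem_splitDeriv] at hx ⊢
  intro β hβ
  obtain ⟨y, hy, z, hz, h1, h2, h3⟩ := hx β hβ
  exact ⟨y, hy, z, hz, hwx.trans h1, hwx.trans h2, h3⟩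

/-- A tree without a copy of the binary tree has an antitone ordinal rank such that the elements
above `x` of the same rank as `x` form a chain. -/
theorem exists_rank (hT : IsTree T) (hbin : ¬ EmbedsBinaryTree T) :
    ∃ rk : T → Ordinal.{u}, Antitone rk ∧
      ∀ x y z, x ≤ y → x ≤ z → rk y = rk x → rk z = rk x → y ≤ z ∨ z ≤ y := by
  classical
  have hout : ∀ x : T, ∃ α, x ∉ splitDeriv (T := T) α := by
    by_contra! hcon
    obtain ⟨r, hr⟩ := hcon
    -- The exit stages are bounded by some `δ`, so whatever survives `δ` survives forever. Points
    -- that never leave get the harmless value `0`.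
    let out : T → Ordinal.{u} := fun x => sInf {α | x ∉ splitDeriv (T := T) α}
    obtain ⟨δ, hδ⟩ := Ordinal.bddAbove_of_small (s := Set.range out)
    have hstab : ∀ y ∈ splitDeriv (T := T) (δ), ∀ α, y ∈ splitDeriv (T := T) α := by
      intro y hy
      by_contra! hne
      have h1 : y ∉ splitDeriv (T := T) (out y) := csInf_mem (s := {α | y ∉ splitDeriv α}) hne
      exact h1 (splitDeriv_anti (hδ ⟨y, rfl⟩) hy)
    refine hbin (embedsBinaryTree_of_splitting hT (S := {x | ∀ α, x ∈ splitDeriv (T := T) α})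
      (r := r) hr ?_)
    intro x hx
    obtain ⟨y, hy, z, hz, h⟩ := mem_splitDeriv.1 (hx (Order.succ δ)) δ (Order.lt_succ δ)
    exact ⟨y, hstab y hy, z, hstab z hz, h⟩
  have hmem : ∀ x : T, x ∉ splitDeriv (T := T) (sInf {α | x ∉ splitDeriv (T := T) α}) :=
    fun x => csInf_mem (s := {α | x ∉ splitDeriv (T := T) α}) (hout x)
  have hlt : ∀ (x : T) β, β < sInf {α | x ∉ splitDeriv (T := T) α} → x ∈ splitDeriv β := by
    intro x β hβ
    by_contra h
    exact absurd (csInf_le' (s := {α | x ∉ splitDeriv (T := T) α}) h) (not_le.2 hβ)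
  refine ⟨fun x => sInf {α | x ∉ splitDeriv (T := T) α}, ?_, ?_⟩
  · intro x y hxy
    exact csInf_le' (fun h => hmem x (isLowerSet_splitDeriv _ hxy h))
  · intro x y z hxy hxz hy hz
    by_contra! hcon
    -- Incomparable `y` and `z` of the rank of `x` would survive every stage before that rank, and
    -- so carry `x` past its own exit stage.
    refine hmem x (mem_splitDeriv.2 fun β hβ => ?_)
    exact ⟨y, hlt y β (hβ.trans_eq hy.symm), z, hlt z β (hβ.trans_eq hz.symm), hxy, hxz, hcon.1, hcon.2⟩

end Rank

/-! ### Decomposition into chains of finite depth -/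

section Depth

/-- Domination of sets by the rank of an element is well founded. -/
lemma wellFounded_rank_dominated {T : Type u} (rk : T → Ordinal.{u}) :
    WellFounded (fun V U : Set T => ∃ w ∈ U, ∀ v ∈ V, rk v < rk w) := by
  have hacc : ∀ (α : Ordinal.{u}) (V : Set T), (∀ v ∈ V, rk v < α) →
      Acc (fun V U : Set T => ∃ w ∈ U, ∀ v ∈ V, rk v < rk w) V := by
    intro α
    induction α using WellFoundedLT.induction with
    | ind α ih =>
      intro V hV
      refine ⟨V, ?_⟩
      rintro W ⟨w, hw, hWw⟩
      exact ih _ (hV w hw) W hWw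
  refine ⟨fun U => ⟨U, ?_⟩⟩
  rintro V ⟨w, -, hV⟩
  exact hacc _ V hV

variable {T : Type u} [PartialOrder T]

/-- The directed component of `x` in `L`. -/
def component (L : Set T) (x : T) : Set T :=
  {y | y ∈ L ∧ ∃ z ∈ L, z ≤ x ∧ z ≤ y}

lemma mem_component_self {L : Set T} {x : T} (hx : x ∈ L) : x ∈ component L x :=
  ⟨hx, x, hx, le_rfl, le_rfl⟩

/-- Two lower bounds of one point are comparable, so having a common lower bound in `L` is
transitive. -/
lemma component_eq (hT : IsTree T) {L : Set T} {x y z : T} (hz : z ∈ L) (hzx : z ≤ x)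
    (hzy : z ≤ y) : component L x = component L y := by
  have aux : ∀ {x y : T}, z ≤ x → z ≤ y → component L x ⊆ component L y := by
    rintro x y hzx hzy w ⟨hw, v, hv, hvx, hvw⟩
    rcases hT.total hvx hzx with h | h
    · exact ⟨hw, v, hv, h.trans hzy, hvw⟩
    · exact ⟨hw, z, hz, hzy, h.trans hvw⟩
  exact (aux hzx hzy).antisymm (aux hzy hzx)

/-- From a directed upper set one can remove an initial chain so that the ranks in every component
of the rest are bounded by the rank of an element of the set. -/
lemma exists_initial_chain (hT : IsTree T) {rk : T → Ordinal.{u}} (hanti : Antitone rk)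
    (hchain : ∀ x y z, x ≤ y → x ≤ z → rk y = rk x → rk z = rk x → y ≤ z ∨ z ≤ y)
    {U : Set T} (hne : U.Nonempty) (hdir : ∀ x ∈ U, ∀ y ∈ U, ∃ z ∈ U, z ≤ x ∧ z ≤ y) :
    ∃ A ⊆ U, A.Nonempty ∧ (∀ a ∈ A, ∀ x ∈ U, x ≤ a → x ∈ A) ∧
      (∀ a ∈ A, ∀ b ∈ A, a ≤ b ∨ b ≤ a) ∧
      ∀ y ∈ U, y ∉ A → ∃ w ∈ U, ∀ v ∈ component (U \ A) y, rk v < rk w := by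
  by_cases hmax : ∃ w ∈ U, ∀ v ∈ U, rk v ≤ rk w
  -- If the rank has a maximum on `U`, remove the points of maximal rank: any two lie above a common
  -- point of `U`, which has the same rank.
  · obtain ⟨w, hw, hwmax⟩ := hmax
    refine ⟨{v | v ∈ U ∧ rk v = rk w}, fun v hv => hv.1, ⟨w, hw, rfl⟩, ?_, ?_, ?_⟩
    · rintro a ⟨ha, haw⟩ x hx hxa
      exact ⟨hx, (hwmax x hx).antisymm (haw ▸ hanti hxa)⟩
    · rintro a ⟨ha, haw⟩ b ⟨hb, hbw⟩
      obtain ⟨z, hz, hza, hzb⟩ := hdir a ha b hb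
      have hzw : rk z = rk w := (hwmax z hz).antisymm (haw ▸ hanti hza)
      exact hchain z a b hza hzb (haw.trans hzw.symm) (hbw.trans hzw.symm)
    · intro y _ _
      refine ⟨w, hw, ?_⟩
      rintro v ⟨⟨hvU, hvA⟩, -⟩
      exact (hwmax v hvU).lt_of_ne fun h => hvA ⟨hvU, h⟩
  -- Otherwise remove the points below an arbitrary `x`. Each remaining component lies above some `z
  -- ≤ x` in `U`, and `rk z` is not maximal.
  · obtain ⟨x, hx⟩ := hne
    refine ⟨{v | v ∈ U ∧ v ≤ x}, fun v hv => hv.1, ⟨x, hx, le_rfl⟩, ?_, ?_, ?_⟩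
    · rintro a ⟨ha, hax⟩ v hv hva
      exact ⟨hv, hva.trans hax⟩
    · rintro a ⟨_, hax⟩ b ⟨_, hbx⟩
      exact hT.total hax hbx
    · intro y hy hyA
      obtain ⟨z, hz, hzx, hzy⟩ := hdir x hx y hy
      push Not at hmax
      obtain ⟨w, hw, hzw⟩ := hmax z hz
      refine ⟨w, hw, ?_⟩
      rintro v ⟨-, z', ⟨hz', hz'A⟩, hz'y, hz'v⟩
      refine lt_of_le_of_lt (hanti ?_) hzw
      rcases hT.total hzy hz'y with h | h
      · exact h.trans hz'v
      · exact absurd ⟨hz', h.trans hzx⟩ hz'A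

/-- Removing from `T` in `ω` steps an initial chain of each component. -/
def level (A : Set T → Set T) : ℕ → Set T
  | 0 => Set.univ
  | n + 1 => {x | x ∈ level A n ∧ x ∉ A (component (level A n) x)}

/-- `d` is the depth function of a decomposition of `T` into chains that are arranged in a tree
without infinite branches. -/
structure IsDepth (d : T → ℕ) : Prop where
  mono : Monotone d
  total : ∀ x y z, z ≤ x → z ≤ y → d x = d z → d y = d z → x ≤ y ∨ y ≤ x
  exists_le : ∀ x n, n ≤ d x → ∃ z ≤ x, d z = n
  wf : WellFounded (fun y x => d y = d x + 1 ∧ ∃ z, z ≤ x ∧ z ≤ y ∧ d z = d x)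

/-- A tree with no copy of the binary tree decomposes into chains arranged in a tree without
infinite branches. -/
theorem exists_depth (hT : IsTree T) (hbin : ¬ EmbedsBinaryTree T) :
    ∃ d : T → ℕ, IsDepth d := by
  classical
  obtain ⟨rk, hanti, hchain⟩ := exists_rank hT hbin
  have hex := fun (U : Set T) (h : U.Nonempty ∧ ∀ x ∈ U, ∀ y ∈ U, ∃ z ∈ U, z ≤ x ∧ z ≤ y) =>
    exists_initial_chain hT hanti hchain h.1 h.2
  choose! A hAU hAne hAlow hAch hAdrop using hex
  set L : ℕ → Set T := level A
  have hL0 : ∀ x, x ∈ L 0 := fun x => Set.mem_univ x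
  have hLs : ∀ n x, x ∈ L (n + 1) ↔ x ∈ L n ∧ x ∉ A (component (L n) x) := fun n x => Iff.rfl
  have hcomp : ∀ n x, x ∈ L n → (component (L n) x).Nonempty ∧
      ∀ a ∈ component (L n) x, ∀ b ∈ component (L n) x,
        ∃ z ∈ component (L n) x, z ≤ a ∧ z ≤ b := by
    intro n x hx
    refine ⟨⟨x, mem_component_self hx⟩, ?_⟩
    rintro a ⟨ha, z, hz, hzx, hza⟩ b ⟨hb, z', hz', hz'x, hz'b⟩
    rcases hT.total hzx hz'x with h | h
    · exact ⟨z, ⟨hz, z, hz, hzx, le_rfl⟩, hza, h.trans hz'b⟩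
    · exact ⟨z', ⟨hz', z', hz', hz'x, le_rfl⟩, h.trans hza, hz'b⟩
  have hup : ∀ n, IsUpperSet (L n) := by
    intro n
    induction n with
    | zero => exact fun _ y _ _ => hL0 y
    | succ n ih =>
      intro x y hxy hx
      rw [hLs] at hx ⊢
      refine ⟨ih hxy hx.1, fun hy => hx.2 ?_⟩
      rw [← component_eq hT hx.1 le_rfl hxy] at hy
      exact hAlow _ (hcomp n x hx.1) y hy x (mem_component_self hx.1) hxy
  have hLanti : Antitone L := antitone_nat_of_succ_le fun n x hx => ((hLs n x).1 hx).1
  have hdrop : ∀ n x, x ∈ L (n + 1) →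
      ∃ w ∈ component (L n) x, ∀ v ∈ component (L (n + 1)) x, rk v < rk w := by
    intro n x hx
    obtain ⟨hx1, hx2⟩ := (hLs n x).1 hx
    obtain ⟨w, hw, hlt⟩ := hAdrop _ (hcomp n x hx1) x (mem_component_self hx1) hx2
    refine ⟨w, hw, fun v hv => hlt v ?_⟩
    have hsub : ∀ y ∈ component (L (n + 1)) x, y ∈ component (L n) x \ A (component (L n) x) := by
      rintro y ⟨hy, z, hz, hzx, hzy⟩
      have hzn := ((hLs n z).1 hz).1
      have hyn := (hLs n y).1 hy
      refine ⟨⟨hyn.1, z, hzn, hzx, hzy⟩, ?_⟩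
      rw [component_eq hT hzn hzx hzy]
      exact hyn.2
    obtain ⟨hv1, z, hz, hzx, hzv⟩ := hv
    exact ⟨hsub v ⟨hv1, z, hz, hzx, hzv⟩, z, hsub z ⟨hz, z, hz, hzx, le_rfl⟩, hzx, hzv⟩
  have hwf := wellFounded_rank_dominated rk
  have hend : ∀ x, ∃ n, x ∉ L (n + 1) := by
    intro x
    by_contra! hall
    -- The components of a point that is never removed would descend forever under domination.
    exact (wellFounded_iff_isEmpty_descending_chain.1 hwf).elim
      ⟨fun n => component (L n) x, fun n => hdrop n x (hall n)⟩
  let d : T → ℕ := fun x => Nat.find (hend x)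
  have hdL : ∀ x, x ∈ L (d x) := by
    intro x
    rcases h : d x with _ | n
    · exact hL0 x
    · by_contra hx
      have : d x ≤ n := Nat.find_min' (hend x) hx
      omega
  have hdL' : ∀ x, x ∉ L (d x + 1) := fun x => Nat.find_spec (hend x)
  have hLd : ∀ n x, x ∈ L n ↔ n ≤ d x := by
    intro n x
    refine ⟨fun h => ?_, fun h => hLanti h (hdL x)⟩
    by_contra hlt
    exact hdL' x (hLanti (by omega) h)
  have hdA : ∀ n x, d x = n ↔ x ∈ L n ∧ x ∈ A (component (L n) x) := by
    intro n x
    have h1 := hLd n x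
    have h2 := hLd (n + 1) x
    rw [hLs] at h2
    constructor
    · intro h
      have hx := h1.2 h.ge
      refine ⟨hx, ?_⟩
      by_contra hA
      have := h2.1 ⟨hx, hA⟩
      omega
    · rintro ⟨hx, hA⟩
      have := h1.1 hx
      by_contra hne
      exact (h2.2 (by omega)).2 hA
  refine ⟨d, fun x y hxy => (hLd _ _).1 (hup _ hxy (hdL x)), ?_, ?_, ?_⟩
  · intro x y z hzx hzy hx hy
    have hz := hdL z
    have hx' := ((hdA _ _).1 hx).2
    have hy' := ((hdA _ _).1 hy).2
    rw [← component_eq hT hz le_rfl hzx] at hx'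
    rw [← component_eq hT hz le_rfl hzy] at hy'
    exact hAch _ (hcomp _ z hz) x hx' y hy'
  · intro x n hn
    have hx := (hLd n x).2 hn
    obtain ⟨a, ha⟩ := hAne _ (hcomp n x hx)
    have haU := hAU _ (hcomp n x hx) ha
    obtain ⟨z, hz, hza, hzx⟩ := (hcomp n x hx).2 a haU x (mem_component_self hx)
    refine ⟨z, hzx, (hdA n z).2 ⟨hz.1, ?_⟩⟩
    rw [component_eq hT hz.1 le_rfl hzx]
    exact hAlow _ (hcomp n x hx) a ha z hz hza
  · refine Subrelation.wf ?_ (InvImage.wf (fun x => component (L (d x)) x) hwf)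
    rintro y x ⟨hyx, z, hzx, hzy, hz⟩
    have h := hdrop (d x) y ((hLd _ _).2 hyx.ge)
    simp only [InvImage, hyx]
    rwa [component_eq hT ((hLd _ z).2 hz.ge) hzx hzy]

end Depth

end MonadicTree
namespace MonadicTree

/-! ### Chains of bounded Hausdorff degree -/

section HausdorffDegree

variable {T : Type u} [PartialOrder T]

/-- The chain `C` has Hausdorff degree at most `k`. -/
def HdegLE : ℕ → Set T → Prop
  | 0, C => C.Finite
  | k + 1, C => ∃ (I : Type u) (_ : LinearOrder I) (f : T → I),
      (WellFoundedLT I ∨ WellFoundedGT I) ∧ MonotoneOn f C ∧ ∀ i : I, HdegLE k {x ∈ C | f x = i}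

lemma HdegLE.mono_set {k : ℕ} {C D : Set T} (h : HdegLE k D) (hCD : C ⊆ D) : HdegLE k C := by
  induction k generalizing C D with
  | zero => exact Set.Finite.subset h hCD
  | succ k ih =>
    obtain ⟨I, _, f, hI, hf, hfib⟩ := h
    exact ⟨I, _, f, hI, hf.mono hCD, fun i => ih (hfib i) fun x hx => ⟨hCD hx.1, hx.2⟩⟩

lemma HdegLE.of_finite {k : ℕ} {C : Set T} (h : C.Finite) : HdegLE k C := by
  induction k generalizing C with
  | zero => exact h
  | succ k ih =>
    exact ⟨PUnit, inferInstance, fun _ => PUnit.unit, Or.inl inferInstance,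
      fun _ _ _ _ _ => le_rfl, fun i => ih (h.subset fun x hx => hx.1)⟩

/-- Unlike an exact degree, the bound passes to subsets and hence from branches to all chains. -/
lemma IsHdeg.hdegLE {k : ℕ} {α : Ordinal.{u}} {C : Set T} (h : IsHdeg α C)
    (hα : α ≤ (k : Ordinal.{u})) : HdegLE k C := by
  induction k generalizing α C with
  | zero =>
    rw [IsHdeg] at h
    rcases h.2 with h | h
    · exact h.2
    · exact absurd h.1 (by simpa using hα)
  | succ k ih =>
    rw [IsHdeg] at h
    rcases h.2 with h | ⟨-, I, _, f, hI, hf, hfib⟩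
    · exact HdegLE.of_finite h.2
    · refine ⟨I, _, f, hI, hf, fun i => ?_⟩
      obtain ⟨β, hβ, hdeg⟩ := hfib i
      refine ih hdeg (Order.lt_succ_iff.1 (hβ.trans_le ?_))
      simpa using hα

/-- In a tree, every chain is contained in a branch. -/
lemma exists_isBranch_superset (hT : IsTree T) {C : Set T} (hC : IsChain (· ≤ ·) C) :
    ∃ B, IsBranch B ∧ C ⊆ B := by
  obtain ⟨B, hB, hCB⟩ := hC.exists_maxChain
  -- A maximal chain of a tree is downward closed, hence convex.
  have hlow : IsLowerSet B := by
    intro b y hyb hb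
    have : IsChain (· ≤ ·) (insert y B) := by
      refine hB.1.insert fun b' hb' _ => ?_
      rcases hB.1.total hb hb' with h | h
      · exact Or.inl (hyb.trans h)
      · exact hT.total hyb h
    rw [hB.2 this (Set.subset_insert y B)]
    exact Set.mem_insert y B
  refine ⟨B, ⟨⟨hlow.ordConnected, hB.1⟩, fun D hD hBD => ?_⟩, hCB⟩
  exact (hB.2 hD.2 hBD).ge

lemma TameFor.hdegLE (hT : IsTree T) {n k : ℕ} (h : TameFor T n k) {C : Set T}
    (hC : IsChain (· ≤ ·) C) : HdegLE k C := by
  obtain ⟨B, hB, hCB⟩ := exists_isBranch_superset hT hC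
  obtain ⟨α, hα, hdeg⟩ := h.hdeg_le B hB
  exact (hdeg.hdegLE hα).mono_set hCB

end HausdorffDegree

/-! ### Lexicographic comparison of cuts in a sum of chains -/

section Lexicographic

variable {T X I : Type*}

/-- `x` lies before `y`, as seen on the pieces of `K` under `E`: some piece that is not
contained in the cut `M x` is contained in the cut `M y`. -/
def FibreLt (K : Set T) (E : T → T → Prop) (M : X → T → Prop) (x y : X) : Prop :=
  ∃ t ∈ K, ¬ M x t ∧ ∀ u ∈ K, E t u → M y u

/-- Comparison of cuts piece by piece, refined by a relation `r` inside the pieces. -/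
def FibreLex (K : Set T) (E : T → T → Prop) (M : X → T → Prop) (r : T → X → X → Prop)
    (x y : X) : Prop :=
  FibreLt K E M x y ∨ (¬ FibreLt K E M y x ∧ ∃ t ∈ K, r t x y)

variable {K : Set T} {E : T → T → Prop} {M : X → T → Prop} {r : T → X → X → Prop}

lemma fibreLex_differ (hrefl : ∀ t ∈ K, E t t)
    (hr : ∀ t ∈ K, ∀ x y, r t x y → ∃ u ∈ K, E t u ∧ ¬ (M x u ↔ M y u)) {x y : X}
    (h : FibreLex K E M r x y) : ∃ u ∈ K, ¬ (M x u ↔ M y u) := by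
  rcases h with ⟨t, ht, hx, hy⟩ | ⟨-, t, ht, h⟩
  · exact ⟨t, ht, fun h => hx (h.2 (hy t ht (hrefl t ht)))⟩
  · obtain ⟨u, hu, -, h⟩ := hr t ht x y h
    exact ⟨u, hu, h⟩

lemma fibreLex_total (hrefl : ∀ t ∈ K, E t t)
    (htri : ∀ t ∈ K, ∀ x y, (∃ u ∈ K, E t u ∧ ¬ (M x u ↔ M y u)) → r t x y ∨ r t y x) {x y : X}
    (h : ∃ u ∈ K, ¬ (M x u ↔ M y u)) : FibreLex K E M r x y ∨ FibreLex K E M r y x := by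
  by_cases h1 : FibreLt K E M x y
  · exact Or.inl (Or.inl h1)
  by_cases h2 : FibreLt K E M y x
  · exact Or.inr (Or.inl h2)
  obtain ⟨u, hu, hne⟩ := h
  rcases htri u hu x y ⟨u, hu, hrefl u hu, hne⟩ with h | h
  · exact Or.inl (Or.inr ⟨h2, u, hu, h⟩)
  · exact Or.inr (Or.inr ⟨h1, u, hu, h⟩)

/-- As cuts are closed downwards along `f`, `FibreLt` compares the first pieces that the cuts do not
exhaust. If these coincide, the cuts differ at most inside that piece, where `r` decides. A minimum
thus comes from minimizing the piece and then `r`. -/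
lemma fibreLex_wellFounded [LinearOrder I] [WellFoundedLT I] {f : T → I}
    (hE : ∀ t ∈ K, ∀ u ∈ K, E t u ↔ f t = f u)
    (hM : ∀ x, ∀ t ∈ K, ∀ u ∈ K, f u < f t → M x t → M x u)
    (hr : ∀ t ∈ K, ∀ x y, r t x y → ∃ u ∈ K, E t u ∧ ¬ (M x u ↔ M y u))
    (hcongr : ∀ t ∈ K, ∀ u ∈ K, E t u → ∀ x y, r t x y → r u x y)
    (hwf : ∀ t ∈ K, WellFounded (r t)) : WellFounded (FibreLex K E M r) := by
  have hrefl : ∀ t ∈ K, E t t := fun t ht => (hE t ht t ht).2 rfl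
  refine WellFounded.wellFounded_iff_has_min.2 fun S hS => ?_
  by_cases hall : ∀ x ∈ S, ∀ t ∈ K, M x t
  · obtain ⟨x, hx⟩ := hS
    refine ⟨x, hx, fun z hz hlex => ?_⟩
    obtain ⟨u, hu, hne⟩ := fibreLex_differ hrefl hr hlex
    exact hne (iff_of_true (hall z hz u hu) (hall x hx u hu))
  push Not at hall
  obtain ⟨x₀, hx₀, t₀, ht₀, hxt₀⟩ := hall
  obtain ⟨i, ⟨t, ht, rfl, x₁, hx₁, hxt⟩, himin⟩ :=
    WellFounded.has_min (wellFounded_lt (α := I))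
      {i | ∃ t ∈ K, f t = i ∧ ∃ x ∈ S, ¬ M x t} ⟨f t₀, t₀, ht₀, rfl, x₀, hx₀, hxt₀⟩
  have hbelow : ∀ u ∈ K, f u < f t → ∀ x ∈ S, M x u := by
    intro u hu hut x hx
    by_contra h
    exact himin (f u) ⟨u, hu, rfl, x, hx, h⟩ hut
  obtain ⟨m, ⟨hmS, u, hu, htu, hmu⟩, hmmin⟩ := (hwf t ht).has_min
    {x | x ∈ S ∧ ∃ u ∈ K, f t = f u ∧ ¬ M x u} ⟨x₁, hx₁, t, ht, rfl, hxt⟩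
  refine ⟨m, hmS, fun z hz hlex => ?_⟩
  rcases hlex with ⟨v, hv, hzv, hmv⟩ | ⟨hnot, v, hv, hrv⟩
  · rcases lt_trichotomy (f v) (f t) with h | h | h
    · exact hzv (hbelow v hv h z hz)
    · exact hmu (hmv u hu ((hE v hv u hu).2 (h.trans htu)))
    · exact hmu (hM m v hv u hu (htu ▸ h) (hmv v hv (hrefl v hv)))
  · have hzS : ∃ w ∈ K, f t = f w ∧ ¬ M z w := by
      by_contra! hcon
      exact hnot ⟨u, hu, hmu, fun w hw huw => hcon w hw (htu.trans ((hE u hu w hw).1 huw))⟩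
    obtain ⟨w, hw, htw, hzw⟩ := hzS
    rcases lt_trichotomy (f v) (f t) with h | h | h
    · obtain ⟨w', hw', hvw', hne⟩ := hr v hv z m hrv
      have hlt : f w' < f t := (hE v hv w' hw').1 hvw' ▸ h
      exact hne (iff_of_true (hbelow w' hw' hlt z hz) (hbelow w' hw' hlt m hmS))
    · exact hmmin z ⟨hz, w, hw, htw, hzw⟩ (hcongr v hv t ht ((hE v hv t ht).2 h) z m hrv)
    · obtain ⟨w', hw', hvw', hne⟩ := hr v hv z m hrv
      have hlt : f t < f w' := (hE v hv w' hw').1 hvw' ▸ h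
      exact hne (iff_of_false (fun h' => hzw (hM z w' hw' w hw (htw ▸ hlt) h'))
        (fun h' => hmu (hM m w' hw' u hu (htu ▸ hlt) h')))

/-- A well order has a two-colouring in which neighbours (within a given subset) have different
colours. -/
lemma exists_alternating_colouring [LinearOrder I] [WellFoundedLT I] (J : Set I) :
    ∃ c : I → Prop, ∀ i ∈ J, ∀ j ∈ J, i < j → (∀ l ∈ J, i < l → j ≤ l) → ¬ (c i ↔ c j) := by
  -- A point is coloured iff it has an immediate predecessor in `J` and that one is not coloured.
  let c : I → Prop := (wellFounded_lt (α := I)).fix fun j ih =>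
    ∃ i, ∃ h : i < j, i ∈ J ∧ (∀ l ∈ J, i < l → j ≤ l) ∧ ¬ ih i h
  have hc : ∀ j, c j ↔ ∃ i, ∃ _ : i < j, i ∈ J ∧ (∀ l ∈ J, i < l → j ≤ l) ∧ ¬ c i := by
    intro j
    exact iff_of_eq (WellFounded.fix_eq _ _ j)
  refine ⟨c, fun i hi j hj hij hnext h => ?_⟩
  by_cases hci : c i
  · obtain ⟨i', hi', hi'J, hnext', hci'⟩ := (hc j).1 (h.1 hci)
    rcases lt_trichotomy i i' with hlt | rfl | hlt
    · exact (hnext i' hi'J hlt).not_gt hi'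
    · exact hci' hci
    · exact (hnext' i hi hlt).not_gt hij
  · exact hci (h.2 ((hc j).2 ⟨i, hij, hi, hnext, hci⟩))

end Lexicographic

/-! ### Well ordering the cuts of chains by means of colourings -/

section Cuts

variable {T : Type u} [PartialOrder T]

/-- `a` and `b` are comparable and everything between them has the colour of `a`. -/
def Mono (c : Set T) (a b : T) : Prop :=
  (a ≤ b ∨ b ≤ a) ∧ ∀ z, (a ≤ z ∧ z ≤ b) ∨ (b ≤ z ∧ z ≤ a) → (z ∈ c ↔ a ∈ c)

/-- If `f a < f b`, the next value after `f a` has the other colour and is attained between `a` and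
`b`. The antitone case serves inverse well orders, read in the dual index order. -/
lemma exists_colour_of_wellFoundedLT {I : Type*} [LinearOrder I] [WellFoundedLT I]
    {K : Set T} (hK : K.OrdConnected) (hch : IsChain (· ≤ ·) K) {f : T → I}
    (hf : MonotoneOn f K ∨ AntitoneOn f K) :
    ∃ c : Set T, ∀ a ∈ K, ∀ b ∈ K, Mono c a b ↔ f a = f b := by
  obtain ⟨c, hc⟩ := exists_alternating_colouring (f '' K)
  refine ⟨{t | c (f t)}, fun a ha b hb => ⟨fun h => ?_, fun h => ⟨hch.total ha hb, ?_⟩⟩⟩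
  · have key : ∀ x ∈ K, ∀ y ∈ K, f x < f y → ∃ z ∈ K,
        ((x ≤ z ∧ z ≤ y) ∨ (y ≤ z ∧ z ≤ x)) ∧ ¬ (c (f x) ↔ c (f z)) := by
      intro x hx y hy hxy
      obtain ⟨l, ⟨⟨z, hz, rfl⟩, hxz⟩, hlmin⟩ := (wellFounded_lt (α := I)).has_min
        {l | l ∈ f '' K ∧ f x < l} ⟨f y, ⟨y, hy, rfl⟩, hxy⟩
      have hcz := hc (f x) ⟨x, hx, rfl⟩ (f z) ⟨z, hz, rfl⟩ hxz
        fun l hl hxl => not_lt.1 (hlmin l ⟨hl, hxl⟩)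
      have hzy : f z ≤ f y := not_lt.1 (hlmin (f y) ⟨⟨y, hy, rfl⟩, hxy⟩)
      rcases hzy.eq_or_lt with heq | hlt
      · refine ⟨y, hy, ?_, heq ▸ hcz⟩
        rcases hch.total hx hy with h | h
        · exact Or.inl ⟨h, le_rfl⟩
        · exact Or.inr ⟨le_rfl, h⟩
      · refine ⟨z, hz, ?_, hcz⟩
        rcases hf with hf | hf
        · exact Or.inl ⟨(hch.total hx hz).resolve_right fun h => (hf hz hx h).not_gt hxz,
            (hch.total hz hy).resolve_right fun h => (hf hy hz h).not_gt hlt⟩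
        · exact Or.inr ⟨(hch.total hy hz).resolve_right fun h => (hf hz hy h).not_gt hlt,
            (hch.total hz hx).resolve_right fun h => (hf hx hz h).not_gt hxz⟩
    rcases lt_trichotomy (f a) (f b) with hlt | heq | hlt
    · obtain ⟨z, hz, hbet, hne⟩ := key a ha b hb hlt
      exact absurd (h.2 z hbet).symm hne
    · exact heq
    · obtain ⟨z, hz, hbet, hne⟩ := key b hb a ha hlt
      have h1 := h.2 z hbet.symm
      have h2 := h.2 b (by rcases h.1 with h | h <;> simp [h])
      exact absurd (h2.trans h1.symm) hne
  · intro z hz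
    have hzf : f z = f a := by
      rcases hz with ⟨h1, h2⟩ | ⟨h1, h2⟩
      · have hzK := hK.out ha hb ⟨h1, h2⟩
        rcases hf with hf | hf
        · exact ((hf hzK hb h2).trans_eq h.symm).antisymm (hf ha hzK h1)
        · exact (hf ha hzK h1).antisymm (h.trans_le (hf hzK hb h2))
      · have hzK := hK.out hb ha ⟨h1, h2⟩
        rcases hf with hf | hf
        · exact (hf hzK ha h2).antisymm (h.trans_le (hf hb hzK h1))
        · exact ((hf hb hzK h1).trans_eq h.symm).antisymm (hf hzK ha h2)
    simp [hzf]

/-- The comparison of the cuts that `x` and `y` make in the class of `s` under `E`. A pair `(c, d)`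
consists of a set `c` whose colour changes mark the pieces of the classes of `E`, and of the set `d`
of those elements in whose class the pieces are compared downwards. -/
def CutLt : List (Set T × Set T) → (T → T → Prop) → T → T → T → Prop
  | [], E, s, x, y => ∃ t, E s t ∧ ¬ t ≤ x ∧ t ≤ y
  | p :: ps, E, s, x, y =>
      (s ∉ p.2 ∧ FibreLex {t | E s t} (fun a b => E a b ∧ Mono p.1 a b) (fun x t => t ≤ x)
        (CutLt ps fun a b => E a b ∧ Mono p.1 a b) x y) ∨
      (s ∈ p.2 ∧ FibreLex {t | E s t} (fun a b => E a b ∧ Mono p.1 a b) (fun x t => ¬ t ≤ x)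
        (CutLt ps fun a b => E a b ∧ Mono p.1 a b) x y)

/-- The recursion consults only points of `G`, so only the traces of the cuts on `G` matter. -/
lemma CutLt.congr {ps : List (Set T × Set T)} {E : T → T → Prop} {G : Set T}
    (hG : ∀ t ∈ G, ∀ u, E t u → u ∈ G) {s x x' y y' : T} (hs : s ∈ G)
    (hx : ∀ u ∈ G, u ≤ x ↔ u ≤ x') (hy : ∀ u ∈ G, u ≤ y ↔ u ≤ y') :
    CutLt ps E s x y ↔ CutLt ps E s x' y' := by
  induction ps generalizing E s x x' y y' with
  | nil =>
    refine exists_congr fun t => and_congr_right fun ht => ?_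
    rw [hx t (hG s hs t ht), hy t (hG s hs t ht)]
  | cons p ps ih =>
    have key : ∀ {x x' y y' : T}, (∀ u ∈ G, u ≤ x ↔ u ≤ x') → (∀ u ∈ G, u ≤ y ↔ u ≤ y') →
        (FibreLt {t | E s t} (fun a b => E a b ∧ Mono p.1 a b) (fun x t => t ≤ x) x y ↔
          FibreLt {t | E s t} (fun a b => E a b ∧ Mono p.1 a b) (fun x t => t ≤ x) x' y') ∧
        (FibreLt {t | E s t} (fun a b => E a b ∧ Mono p.1 a b) (fun x t => ¬ t ≤ x) x y ↔
          FibreLt {t | E s t} (fun a b => E a b ∧ Mono p.1 a b) (fun x t => ¬ t ≤ x) x' y') := by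
      intro x x' y y' hx hy
      constructor <;>
      · refine exists_congr fun t => and_congr_right fun ht => ?_
        beta_reduce
        rw [hx t (hG s hs t ht)]
        refine and_congr_right fun _ => forall₂_congr fun u hu => ?_
        rw [hy u (hG s hs u hu)]
    have hr : (∃ t ∈ {t | E s t}, CutLt ps (fun a b => E a b ∧ Mono p.1 a b) t x y) ↔
        ∃ t ∈ {t | E s t}, CutLt ps (fun a b => E a b ∧ Mono p.1 a b) t x' y' :=
      exists_congr fun t => and_congr_right fun ht =>
        ih (fun t ht u hu => hG t ht u hu.1) (hG s hs t ht) hx hy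
    simp only [CutLt, FibreLex]
    rw [(key hx hy).1, (key hx hy).2, (key hy hx).1, (key hy hx).2, hr]

/-- If the classes of `E` are convex chains of bounded Hausdorff degree, finitely many parameters
make `CutLt` a well ordering of the cuts in each class. -/
theorem exists_cutLt_wellOrder (k : ℕ) (E : T → T → Prop) (hE : Equivalence E)
    (htot : ∀ a b, E a b → a ≤ b ∨ b ≤ a) (hconv : ∀ a b z, E a b → a ≤ z → z ≤ b → E a z)
    (hdeg : ∀ s, HdegLE k {t | E s t}) :
    ∃ ps : List (Set T × Set T),
      (∀ s s', E s s' → ∀ x y, CutLt ps E s x y → CutLt ps E s' x y) ∧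
      (∀ s x y, CutLt ps E s x y → ∃ t, E s t ∧ ¬ (t ≤ x ↔ t ≤ y)) ∧
      (∀ s x y, (∃ t, E s t ∧ ¬ (t ≤ x ↔ t ≤ y)) → CutLt ps E s x y ∨ CutLt ps E s y x) ∧
      ∀ s, WellFounded (CutLt ps E s) := by
  classical
  induction k generalizing E with
  | zero =>
    refine ⟨[], ?_, ?_, ?_, ?_⟩
    · rintro s s' hss x y ⟨t, ht, h⟩
      exact ⟨t, hE.trans (hE.symm hss) ht, h⟩
    · rintro s x y ⟨t, ht, hx, hy⟩
      exact ⟨t, ht, fun h => hx (h.2 hy)⟩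
    · rintro s x y ⟨t, ht, hne⟩
      by_cases h : t ≤ x
      · exact Or.inr ⟨t, ht, fun h' => hne (iff_of_true h h'), h⟩
      · exact Or.inl ⟨t, ht, h, by_contra fun h' => hne (iff_of_false h h')⟩
    · intro s
      have hfin : {t | E s t}.Finite := hdeg s
      -- In a finite chain the cuts are ordered by the number of their elements.
      refine Subrelation.wf ?_
        (InvImage.wf (fun x => {t | E s t ∧ t ≤ x}.ncard) (wellFounded_lt (α := ℕ)))
      rintro x y ⟨t, ht, hx, hy⟩
      refine Set.ncard_lt_ncard ?_ (hfin.subset fun t h => h.1)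
      refine (Set.ssubset_iff_of_subset ?_).2 ⟨t, ⟨ht, hy⟩, fun h => hx h.2⟩
      rintro u ⟨hu, hux⟩
      refine ⟨hu, ?_⟩
      rcases htot u t (hE.trans (hE.symm hu) ht) with h | h
      · exact h.trans hy
      · exact absurd (h.trans hux) hx
  | succ k ih =>
    -- Colourings and directions are chosen at one representative of each class, which glues them to
    -- single sets `C` and `D` for all classes.
    let S : Setoid T := ⟨E, hE⟩
    let rep : T → T := fun t => (Quotient.mk S t).out
    have hrep : ∀ t, E t (rep t) := fun t => hE.symm (Quotient.mk_out (s := S) t)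
    have hrepeq : ∀ {a b}, E a b → rep a = rep b := fun {a b} h =>
      congrArg Quotient.out (Quotient.sound (s := S) h)
    choose I inst f hI hf hfib using hdeg
    have hconn : ∀ s, {t | E s t}.OrdConnected := by
      intro s
      refine ⟨fun a ha b hb z hz => ?_⟩
      exact hE.trans ha (hconv a b z (hE.trans (hE.symm ha) hb) hz.1 hz.2)
    have hchain : ∀ s, IsChain (· ≤ ·) {t | E s t} :=
      fun s a ha b hb _ => htot a b (hE.trans (hE.symm ha) hb)
    have hcol : ∀ s, ∃ c : Set T, ∀ a, E s a → ∀ b, E s b → (Mono c a b ↔ f s a = f s b) := by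
      intro s
      rcases hI s with h | h
      · exact exists_colour_of_wellFoundedLT (hconn s) (hchain s) (Or.inl (hf s))
      · exact exists_colour_of_wellFoundedLT (I := (I s)ᵒᵈ) (hconn s) (hchain s)
          (f := fun t => OrderDual.toDual (f s t)) (Or.inr (hf s))
    choose c hc using hcol
    let C : Set T := {t | t ∈ c (rep t)}
    let D : Set T := {t | ¬ WellFoundedLT (I (rep t))}
    have hmono : ∀ a b, E a b → (Mono C a b ↔ f (rep a) a = f (rep a) b) := by
      intro a b hab
      rw [← hc (rep a) a (hE.symm (hrep a)) b (hE.trans (hE.symm (hrep a)) hab)]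
      refine and_congr_right fun _ => forall_congr' fun z => forall_congr' fun hz => ?_
      have haz : E a z := by
        rcases hz with ⟨h1, h2⟩ | ⟨h1, h2⟩
        · exact hconv a b z hab h1 h2
        · exact hE.trans hab (hconv b a z (hE.symm hab) h1 h2)
      simp [C, hrepeq haz]
    set E' : T → T → Prop := fun a b => E a b ∧ Mono C a b
    have hE'iff : ∀ a b, E' a b ↔ E a b ∧ f (rep a) a = f (rep a) b := fun a b =>
      and_congr_right (hmono a b)
    have hE' : Equivalence E' := by
      refine ⟨fun a => (hE'iff a a).2 ⟨hE.refl a, rfl⟩, ?_, ?_⟩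
      · intro a b h
        rw [hE'iff] at h ⊢
        exact ⟨hE.symm h.1, by rw [← hrepeq h.1]; exact h.2.symm⟩
      · intro a b z h h'
        rw [hE'iff] at h h' ⊢
        rw [← hrepeq h.1] at h'
        exact ⟨hE.trans h.1 h'.1, h.2.trans h'.2⟩
    obtain ⟨ps, hcongr, hdiff, htri, hwf⟩ := ih E' hE' (fun a b h => htot a b h.1)
      (by
        intro a b z h haz hzb
        refine ⟨hconv a b z h.1 haz hzb, Or.inl haz, fun w hw => h.2.2 w ?_⟩
        rcases hw with hw | hw
        · exact Or.inl ⟨hw.1, hw.2.trans hzb⟩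
        · exact Or.inl ⟨haz.trans hw.1, hw.2.trans (haz.trans hzb)⟩)
      (by
        intro s
        refine (hfib (rep s) (f (rep s) s)).mono_set fun t ht => ?_
        have := (hE'iff s t).1 ht
        exact ⟨hE.trans (hE.symm (hrep s)) this.1, this.2.symm⟩)
    have hdiff1 : ∀ s, ∀ t ∈ {t | E s t}, ∀ x y, CutLt ps E' t x y →
        ∃ u ∈ {t | E s t}, E' t u ∧ ¬ (u ≤ x ↔ u ≤ y) := by
      intro s t ht x y h
      obtain ⟨u, hu, hne⟩ := hdiff t x y h
      exact ⟨u, hE.trans ht hu.1, hu, hne⟩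
    have hdiff2 : ∀ s, ∀ t ∈ {t | E s t}, ∀ x y, CutLt ps E' t x y →
        ∃ u ∈ {t | E s t}, E' t u ∧ ¬ (¬ u ≤ x ↔ ¬ u ≤ y) := by
      simpa only [not_iff_not] using hdiff1
    have htri1 : ∀ s, ∀ t ∈ {t | E s t}, ∀ x y,
        (∃ u ∈ {t | E s t}, E' t u ∧ ¬ (u ≤ x ↔ u ≤ y)) →
          CutLt ps E' t x y ∨ CutLt ps E' t y x := by
      rintro s t ht x y ⟨u, hu, htu, hne⟩
      exact htri t x y ⟨u, htu, hne⟩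
    have htri2 : ∀ s, ∀ t ∈ {t | E s t}, ∀ x y,
        (∃ u ∈ {t | E s t}, E' t u ∧ ¬ (¬ u ≤ x ↔ ¬ u ≤ y)) →
          CutLt ps E' t x y ∨ CutLt ps E' t y x := by
      simpa only [not_iff_not] using htri1
    have hEf : ∀ s, ∀ t ∈ {t | E s t}, ∀ u ∈ {t | E s t},
        E' t u ↔ f (rep s) t = f (rep s) u := by
      intro s t ht u hu
      rw [hE'iff, ← hrepeq ht]
      exact and_iff_right (hE.trans (hE.symm ht) hu)
    have hmem : ∀ {s t}, E s t → E (rep s) t := fun {s t} h => hE.trans (hE.symm (hrep s)) h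
    refine ⟨(C, D) :: ps, ?_, ?_, ?_, ?_⟩
    · intro s s' hss x y h
      have hset : {t | E s t} = {t | E s' t} :=
        Set.ext fun t => ⟨fun h => hE.trans (hE.symm hss) h, fun h => hE.trans hss h⟩
      have hD : s ∈ D ↔ s' ∈ D := by
        change ¬ WellFoundedLT (I (rep s)) ↔ ¬ WellFoundedLT (I (rep s'))
        rw [hrepeq hss]
      simp only [CutLt] at h ⊢
      rwa [← hset, ← hD]
    · intro s x y h
      rcases h with ⟨-, h⟩ | ⟨-, h⟩
      · exact fibreLex_differ (fun t _ => hE'.refl t) (hdiff1 s) h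
      · simpa only [not_iff_not, Set.mem_ofPred_eq] using fibreLex_differ (fun t _ => hE'.refl t) (hdiff2 s) h
    · intro s x y h
      by_cases hs : s ∈ D
      · rcases fibreLex_total (fun t _ => hE'.refl t) (htri2 s)
          (by simpa only [not_iff_not, Set.mem_ofPred_eq] using h) with h | h
        · exact Or.inl (Or.inr ⟨hs, h⟩)
        · exact Or.inr (Or.inr ⟨hs, h⟩)
      · rcases fibreLex_total (fun t _ => hE'.refl t) (htri1 s) h with h | h
        · exact Or.inl (Or.inl ⟨hs, h⟩)
        · exact Or.inr (Or.inl ⟨hs, h⟩)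
    · intro s
      have hcg : ∀ t ∈ {t | E s t}, ∀ u ∈ {t | E s t}, E' t u →
          ∀ x y, CutLt ps E' t x y → CutLt ps E' u x y := fun t _ u _ h => hcongr t u h
      by_cases hs : s ∈ D
      -- Along the dual index order it is the complements of the cuts that are closed downwards.
      · have : WellFoundedGT (I (rep s)) := (hI (rep s)).resolve_left hs
        refine Subrelation.wf ?_ (fibreLex_wellFounded (I := (I (rep s))ᵒᵈ)
          (f := fun t => OrderDual.toDual (f (rep s) t)) (M := fun x t => ¬ t ≤ x)
          (hEf s) ?_ (hdiff2 s) hcg fun t _ => hwf t)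
        · intro x y h
          exact (h.resolve_left fun h => h.1 hs).2
        · intro x t ht u hu hlt hx hux
          have hlt' : f (rep s) t < f (rep s) u := hlt
          refine hx (le_trans ?_ hux)
          exact ((hchain s).total ht hu).resolve_right fun h =>
            (hf (rep s) (hmem hu) (hmem ht) h).not_gt hlt'
      · have : WellFoundedLT (I (rep s)) := not_not.1 hs
        refine Subrelation.wf ?_ (fibreLex_wellFounded
          (f := f (rep s)) (M := fun x t => t ≤ x)
          (hEf s) ?_ (hdiff1 s) hcg fun t _ => hwf t)
        · intro x y h
          exact (h.resolve_right fun h => hs h.1).2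
        · intro x t ht u hu hlt hx
          refine le_trans ?_ hx
          exact ((hchain s).total hu ht).resolve_right fun h =>
            (hf (rep s) (hmem ht) (hmem hu) h).not_gt hlt

end Cuts

end MonadicTree
namespace MonadicTree

/-! ### The well ordering of the tree -/

section Order

variable {T : Type u} [PartialOrder T]

/-- `s` is a common lower bound of `x` and `y` of maximal depth. -/
def Meet (E : T → T → Prop) (s x y : T) : Prop :=
  s ≤ x ∧ s ≤ y ∧ ∀ z, z ≤ x → z ≤ y → z ≤ s ∨ E z s

/-- `x` and `y` leave their deepest common chain at cuts that are ordered by `CutLt`. -/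
def MeetCutLt (ps : List (Set T × Set T)) (E : T → T → Prop) (x y : T) : Prop :=
  ∃ s, Meet E s x y ∧ CutLt ps E s x y

/-- `z` is an element below `x` of the first chain that is not shared with `y`. -/
def FirstApart (E : T → T → Prop) (z x y : T) : Prop :=
  z ≤ x ∧ (¬ ∃ w, E z w ∧ w ≤ y) ∧ ∀ w, w ≤ z → E w z ∨ ∃ w', E w w' ∧ w' ≤ y

/-- Comparison of the numbers of the components in which `x` and `y` lie after they split. -/
def NumLt (Ms : List (Set T)) (E : T → T → Prop) (x y : T) : Prop :=
  ∃ M ∈ Ms, (∃ z, z ∈ M ∧ FirstApart E z x y) ∧ ¬ ∃ z, z ∈ M ∧ FirstApart E z y x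

/-- The ordering of the tree. -/
def TreeLt (ps : List (Set T × Set T)) (Ms : List (Set T)) (E : T → T → Prop) (x y : T) : Prop :=
  MeetCutLt ps E x y ∨ (¬ MeetCutLt ps E y x ∧ NumLt Ms E x y)

/-- The first `m` chains below `x` and `y` are shared. -/
def Common (d : T → ℕ) (m : ℕ) (x y : T) : Prop :=
  ∀ i < m, ∃ z, z ≤ x ∧ z ≤ y ∧ d z = i

/-- Exactly the first `m` chains below `x` and `y` are shared. -/
def Split (d : T → ℕ) (m : ℕ) (x y : T) : Prop :=
  Common d m x y ∧ ∀ z, z ≤ x → z ≤ y → d z < m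

lemma Common.symm {d : T → ℕ} {m : ℕ} {x y : T} (h : Common d m x y) : Common d m y x :=
  fun i hi => let ⟨z, h1, h2, h3⟩ := h i hi; ⟨z, h2, h1, h3⟩

lemma Split.symm {d : T → ℕ} {m : ℕ} {x y : T} (h : Split d m x y) : Split d m y x :=
  ⟨h.1.symm, fun z h1 h2 => h.2 z h2 h1⟩

namespace IsDepth

variable {d : T → ℕ}

/-- A common lower bound `z` witnesses `d z + 1` shared chains, of depths `0` to `d z`. -/
lemma common_of_le (hd : IsDepth d) {m : ℕ} {x y z : T} (hzx : z ≤ x) (hzy : z ≤ y) (hz : m ≤ d z + 1) :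
    Common d m x y := by
  intro i hi
  obtain ⟨w, hwz, hw⟩ := hd.exists_le z i (by omega)
  exact ⟨w, hwz.trans hzx, hwz.trans hzy, hw⟩

lemma exists_split (hd : IsDepth d) (x y : T) : ∃ m, Split d m x y := by
  classical
  have hex : ∃ m, ∀ z, z ≤ x → z ≤ y → d z < m :=
    ⟨d x + 1, fun z hz _ => Nat.lt_succ_of_le (hd.mono hz)⟩
  refine ⟨Nat.find hex, fun i hi => ?_, Nat.find_spec hex⟩
  have := Nat.find_min hex hi
  push Not at this
  obtain ⟨z, hzx, hzy, hz⟩ := this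
  exact hd.common_of_le hzx hzy (Nat.succ_le_succ hz) i (Nat.lt_succ_self i)

lemma le_of_depth_lt (hd : IsDepth d) (hT : IsTree T) {t z x : T} (ht : t ≤ x) (hz : z ≤ x) (h : d t < d z) :
    t ≤ z :=
  (hT.total ht hz).resolve_right fun h' => (hd.mono h').not_gt h

/-- The relation of lying in the same chain of the decomposition. -/
lemma equivalence (hd : IsDepth d) (hT : IsTree T) {E : T → T → Prop}
    (hE : ∀ a b, E a b ↔ (a ≤ b ∨ b ≤ a) ∧ d a = d b) : Equivalence E := by
  refine ⟨fun a => (hE a a).2 ⟨Or.inl le_rfl, rfl⟩, ?_, ?_⟩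
  · intro a b h
    rw [hE] at h ⊢
    exact ⟨h.1.symm, h.2.symm⟩
  · intro a b c h h'
    rw [hE] at h h' ⊢
    refine ⟨?_, h.2.trans h'.2⟩
    rcases h.1 with h1 | h1 <;> rcases h'.1 with h2 | h2
    · exact Or.inl (h1.trans h2)
    · exact hT.total h1 h2
    · exact hd.total a c b h1 h2 h.2 h'.2.symm
    · exact Or.inr (h2.trans h1)

/-- The colour changes of the parity of the depth mark the chains of the decomposition. -/
lemma mono_even_iff (hd : IsDepth d) (hT : IsTree T) (a b : T) :
    Mono {x | Even (d x)} a b ↔ (a ≤ b ∨ b ≤ a) ∧ d a = d b := by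
  refine and_congr_right fun hab => ⟨fun h => ?_, fun h z hz => ?_⟩
  · have key : ∀ {x y : T}, x ≤ y → (∀ z, x ≤ z → z ≤ y → (Even (d z) ↔ Even (d x))) →
        d x = d y := by
      intro x y hxy hz
      by_contra hne
      have hlt : d x < d y := lt_of_le_of_ne (hd.mono hxy) hne
      -- The depth skips no value, so an increase passes through `d x + 1`, which has the other
      -- parity.
      obtain ⟨z, hzy, hdz⟩ := hd.exists_le y (d x + 1) hlt
      have hxz := hd.le_of_depth_lt hT hxy hzy (by omega)
      have := hz z hxz hzy
      rw [hdz, Nat.even_add_one] at this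
      tauto
    rcases hab with h' | h'
    · exact key h' fun z h1 h2 => h z (Or.inl ⟨h1, h2⟩)
    · have hb := h b (Or.inr ⟨le_rfl, h'⟩)
      exact (key h' fun z h1 h2 => (h z (Or.inr ⟨h1, h2⟩)).trans hb.symm).symm
  · have hz' : d z = d a := by
      rcases hz with ⟨h1, h2⟩ | ⟨h1, h2⟩
      · exact le_antisymm ((hd.mono h2).trans_eq h.symm) (hd.mono h1)
      · exact le_antisymm (hd.mono h2) (h.trans_le (hd.mono h1))
    simp [hz']

/-- In a tame tree, the components above a given cut can be numbered by fewer than `n` numbers. -/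
lemma exists_num (hd : IsDepth d) (hT : IsTree T) {n : ℕ}
    (hn : ∀ A : Set T, IsInitialSegment A → (topClasses A).encard ≤ n) :
    ∃ num : T → ℕ, (∀ x, num x < n) ∧
      (∀ x z, z ≤ x → d z = d x → num z = num x) ∧
      ∀ x y, d x = d y → (∀ t, d t < d x → (t ≤ x ↔ t ≤ y)) → num x = num y →
        ∃ z, z ≤ x ∧ z ≤ y ∧ d z = d x := by
  classical
  have hemb : ∀ A : Set T, IsInitialSegment A →
      ∃ g : Set T → ℕ, (∀ C ∈ topClasses A, g C < n) ∧ Set.InjOn g (topClasses A) := by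
    intro A hA
    have hfin : (topClasses A).Finite := Set.finite_of_encard_le_coe (hn A hA)
    obtain ⟨g, hg⟩ := hfin.exists_injOn_of_encard_le (t := Set.Iio n)
      (by simpa [Set.encard_eq_coe_toFinset_card] using hn A hA)
    exact ⟨g, fun C hC => hg.1 hC, hg.2⟩
  choose! g hglt hginj using hemb
  -- For this initial segment the `∼¹`-class of `x` consists of the points that lie above some
  -- element, below `x`, of the chain of `x`; `num x` is the number of that class.
  let A : T → Set T := fun x => {t | t ≤ x ∧ d t < d x}
  have hA : ∀ x, IsInitialSegment (A x) := by
    intro x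
    have hlow : IsLowerSet (A x) := fun a b hba ha =>
      ⟨hba.trans ha.1, (hd.mono hba).trans_lt ha.2⟩
    exact ⟨⟨hlow.ordConnected, fun a ha b hb _ => hT.total ha.1 hb.1⟩, hlow⟩
  have hclass : ∀ x, {y | Sim1 (A x) x y} = {y | ∃ z, z ≤ x ∧ z ≤ y ∧ d z = d x} := by
    intro x
    ext y
    constructor
    · rintro ⟨-, z, hzx, hzy, hz⟩
      refine ⟨z, hzx, hzy, le_antisymm (hd.mono hzx) (not_lt.1 fun h => hz.1 ⟨hzx, h⟩)⟩
    · rintro ⟨z, hzx, hzy, hz⟩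
      have hxA : x ∉ A x := fun h => lt_irrefl _ h.2
      have hzA : z ∉ A x := fun h => h.2.ne hz
      have hle : ∀ t ∈ A x, t ≤ z := fun t ht =>
        hd.le_of_depth_lt hT ht.1 hzx (hz ▸ ht.2)
      refine ⟨⟨hxA, fun h => ?_, fun t ht => iff_of_true ht.1 ((hle t ht).trans hzy)⟩,
        z, hzx, hzy, hzA, hxA, fun t ht => iff_of_true (hle t ht) ht.1⟩
      exact (hd.mono hzy).not_gt (hz ▸ h.2)
  have htop : ∀ x, {y | Sim1 (A x) x y} ∈ topClasses (A x) := fun x =>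
    ⟨x, ⟨fun t ht => ht.1, fun h => lt_irrefl _ h.2⟩, rfl⟩
  have hAeq : ∀ {x y}, d x = d y → (∀ t, d t < d x → (t ≤ x ↔ t ≤ y)) → A x = A y := by
    intro x y hxy h
    ext t
    constructor
    · rintro ⟨h1, h2⟩
      exact ⟨(h t h2).1 h1, hxy ▸ h2⟩
    · rintro ⟨h1, h2⟩
      have h2' : d t < d x := hxy ▸ h2
      exact ⟨(h t h2').2 h1, h2'⟩
  refine ⟨fun x => g (A x) {y | Sim1 (A x) x y}, fun x => hglt _ (hA x) _ (htop x), ?_, ?_⟩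
  · intro x z hzx hz
    have h1 : A z = A x := hAeq hz fun t ht =>
      ⟨fun h => h.trans hzx, fun h => hd.le_of_depth_lt hT h hzx ht⟩
    have h2 : {y | Sim1 (A z) z y} = {y | Sim1 (A x) x y} := by
      rw [hclass, hclass]
      ext y
      constructor
      · rintro ⟨w, hwz, hwy, hw⟩
        exact ⟨w, hwz.trans hzx, hwy, hw.trans hz⟩
      · rintro ⟨w, hwx, hwy, hw⟩
        rcases hT.total hwx hzx with h | h
        · exact ⟨w, h, hwy, hw.trans hz.symm⟩
        · exact ⟨z, le_rfl, h.trans hwy, rfl⟩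
    simp only [h2]
    rw [h1]
  · intro x y hxy hsame hnum
    have h1 := hAeq hxy hsame
    have h2 : {w | Sim1 (A y) y w} ∈ topClasses (A x) := h1 ▸ htop y
    have h3 : {w | Sim1 (A x) x w} = {w | Sim1 (A y) y w} :=
      hginj (A x) (hA x) (htop x) h2 (by simpa only [h1] using hnum)
    rw [hclass, hclass] at h3
    have : y ∈ {w | ∃ z, z ≤ x ∧ z ≤ w ∧ d z = d x} := by
      rw [h3]; exact ⟨y, le_rfl, le_rfl, rfl⟩
    exact this

end IsDepth

/-- The data from which `TreeLt` is a well ordering. -/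
structure IsCoding (d : T → ℕ) (E : T → T → Prop) (ps : List (Set T × Set T)) (n : ℕ)
    (num : T → ℕ) : Prop where
  tree : IsTree T
  depth : IsDepth d
  rel_iff : ∀ a b, E a b ↔ (a ≤ b ∨ b ≤ a) ∧ d a = d b
  cut_congr : ∀ s s', E s s' → ∀ x y, CutLt ps E s x y → CutLt ps E s' x y
  cut_differ : ∀ s x y, CutLt ps E s x y → ∃ t, E s t ∧ ¬ (t ≤ x ↔ t ≤ y)
  cut_total : ∀ s x y, (∃ t, E s t ∧ ¬ (t ≤ x ↔ t ≤ y)) → CutLt ps E s x y ∨ CutLt ps E s y x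
  cut_wf : ∀ s, WellFounded (CutLt ps E s)
  num_lt : ∀ x, num x < n
  num_eq : ∀ x z, z ≤ x → d z = d x → num z = num x
  num_conn : ∀ x y, d x = d y → (∀ t, d t < d x → (t ≤ x ↔ t ≤ y)) → num x = num y →
    ∃ z, z ≤ x ∧ z ≤ y ∧ d z = d x

/-- The sets that record the numbers of the components. -/
def numSets (n : ℕ) (num : T → ℕ) : List (Set T) :=
  (List.range n).map fun j => {z | num z ≤ j}

open Classical in
/-- The number of the chain of depth `m` below `x`, and `n` if there is none. -/
noncomputable def lowNum (d : T → ℕ) (n : ℕ) (num : T → ℕ) (m : ℕ) (x : T) : ℕ :=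
  if h : ∃ z, z ≤ x ∧ d z = m then num h.choose else n

namespace IsCoding

variable {d : T → ℕ} {E : T → T → Prop} {ps : List (Set T × Set T)} {n : ℕ} {num : T → ℕ}

lemma rel_equiv (hC : IsCoding d E ps n num) : Equivalence E := hC.depth.equivalence hC.tree hC.rel_iff

lemma rel_of_le (hC : IsCoding d E ps n num) {a b x : T} (ha : a ≤ x) (hb : b ≤ x) (hab : d a = d b) : E a b :=
  (hC.rel_iff a b).2 ⟨hC.tree.total ha hb, hab⟩

lemma lowNum_eq (hC : IsCoding d E ps n num) {m : ℕ} {x z : T} (hzx : z ≤ x) (hz : d z = m) :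
    lowNum d n num m x = num z := by
  have h : ∃ z, z ≤ x ∧ d z = m := ⟨z, hzx, hz⟩
  rw [lowNum, dif_pos h]
  obtain ⟨h1, h2⟩ := h.choose_spec
  rcases hC.tree.total h1 hzx with h' | h'
  · exact hC.num_eq _ _ h' (h2.trans hz.symm)
  · exact (hC.num_eq _ _ h' (hz.trans h2.symm)).symm

/-- The default value `n` exceeds every threshold `j < n`, so a missing chain never counts. -/
lemma lowNum_le_iff (hC : IsCoding d E ps n num) {m j : ℕ} (hj : j < n) {x : T} :
    lowNum d n num m x ≤ j ↔ ∃ z, num z ≤ j ∧ z ≤ x ∧ d z = m := by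
  constructor
  · intro h
    by_cases hex : ∃ z, z ≤ x ∧ d z = m
    · obtain ⟨z, hzx, hz⟩ := hex
      exact ⟨z, hC.lowNum_eq hzx hz ▸ h, hzx, hz⟩
    · rw [lowNum, dif_neg hex] at h
      omega
  · rintro ⟨z, hzj, hzx, hz⟩
    rwa [hC.lowNum_eq hzx hz]

/-- `FirstApart` mentions only the order and `E`, hence is definable, although the depth itself is
not available to a formula. -/
lemma firstApart_iff (hC : IsCoding d E ps n num) {m : ℕ} {x y z : T} (h : Split d m x y) :
    FirstApart E z x y ↔ z ≤ x ∧ d z = m := by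
  have hno : ∀ z w, z ≤ x → d z = m → E z w → w ≤ y → False := by
    intro z w hzx hz hzw hwy
    obtain ⟨hcmp, hdw⟩ := (hC.rel_iff z w).1 hzw
    rcases hcmp with h' | h'
    · exact absurd (h.2 z hzx (h'.trans hwy)) (by omega)
    · exact absurd (h.2 w (h'.trans hzx) hwy) (by omega)
  constructor
  · rintro ⟨hzx, hzy, hlow⟩
    refine ⟨hzx, ?_⟩
    rcases lt_trichotomy (d z) m with hlt | heq | hgt
    · obtain ⟨u, hux, huy, hu⟩ := h.1 _ hlt
      exact absurd ⟨u, hC.rel_of_le hzx hux hu.symm, huy⟩ hzy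
    · exact heq
    · obtain ⟨w, hwz, hw⟩ := hC.depth.exists_le z m hgt.le
      rcases hlow w hwz with h' | ⟨w', hww', hw'y⟩
      · have := ((hC.rel_iff w z).1 h').2
        omega
      · exact (hno w w' (hwz.trans hzx) hw hww' hw'y).elim
  · rintro ⟨hzx, hz⟩
    refine ⟨hzx, fun ⟨w, hzw, hwy⟩ => hno z w hzx hz hzw hwy, fun w hwz => ?_⟩
    rcases (hC.depth.mono hwz).eq_or_lt with heq | hlt
    · exact Or.inl (hC.rel_of_le hwz le_rfl heq)
    · obtain ⟨u, hux, huy, hu⟩ := h.1 (d w) (hz ▸ hlt)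
      exact Or.inr ⟨u, hC.rel_of_le (hwz.trans hzx) hux hu.symm, huy⟩

lemma meet_iff (hC : IsCoding d E ps n num) {m : ℕ} {x y s : T} (h : Split d (m + 1) x y) :
    Meet E s x y ↔ s ≤ x ∧ s ≤ y ∧ d s = m := by
  constructor
  · rintro ⟨hx, hy, hs⟩
    refine ⟨hx, hy, le_antisymm (Nat.lt_succ_iff.1 (h.2 s hx hy)) ?_⟩
    obtain ⟨z, hzx, hzy, hz⟩ := h.1 m (Nat.lt_succ_self m)
    rcases hs z hzx hzy with h' | h'
    · exact hz ▸ hC.depth.mono h'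
    · exact (hz.symm.trans ((hC.rel_iff z s).1 h').2).le
  · rintro ⟨hx, hy, hs⟩
    refine ⟨hx, hy, fun z hzx hzy => ?_⟩
    have hzm := h.2 z hzx hzy
    rcases (show d z < m ∨ d z = m by omega) with h' | h'
    · exact Or.inl (hC.depth.le_of_depth_lt hC.tree hzx hx (hs ▸ h'))
    · exact Or.inr (hC.rel_of_le hzx hx (h'.trans hs.symm))

lemma not_meet_of_split_zero {x y s : T} (h : Split d 0 x y) : ¬ Meet E s x y :=
  fun hs => absurd (h.2 s hs.1 hs.2.1) (Nat.not_lt_zero _)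

lemma numLt_iff (hC : IsCoding d E ps n num) {m : ℕ} {x y : T} (h : Split d m x y) :
    NumLt (numSets n num) E x y ↔ lowNum d n num m x < lowNum d n num m y := by
  have hbound : ∀ x, lowNum d n num m x ≤ n := by
    intro x
    by_cases hex : ∃ z, z ≤ x ∧ d z = m
    · obtain ⟨z, hzx, hz⟩ := hex
      exact hC.lowNum_eq hzx hz ▸ (hC.num_lt z).le
    · rw [lowNum, dif_neg hex]
  have hset : ∀ j < n, ∀ {x y : T}, Split d m x y →
      ((∃ z, z ∈ {z | num z ≤ j} ∧ FirstApart E z x y) ↔ lowNum d n num m x ≤ j) := by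
    intro j hj x y hxy
    rw [hC.lowNum_le_iff hj]
    exact exists_congr fun z => and_congr_right fun _ => hC.firstApart_iff hxy
  constructor
  · rintro ⟨M, hM, h1, h2⟩
    obtain ⟨j, hj, rfl⟩ := List.mem_map.1 hM
    have hj' := List.mem_range.1 hj
    rw [hset j hj' h] at h1
    rw [hset j hj' h.symm] at h2
    omega
  · intro hlt
    -- The number of `x` itself is the separating threshold.
    have hj : lowNum d n num m x < n := hlt.trans_le (hbound y)
    refine ⟨_, List.mem_map.2 ⟨_, List.mem_range.2 hj, rfl⟩, ?_, ?_⟩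
    · rw [hset _ hj h]
    · rw [hset _ hj h.symm]
      omega

lemma not_treeLt_self (hC : IsCoding d E ps n num) (x : T) : ¬ TreeLt ps (numSets n num) E x x := by
  rintro (⟨s, -, h⟩ | ⟨-, h⟩)
  · obtain ⟨t, -, hne⟩ := hC.cut_differ s x x h
    exact hne Iff.rfl
  · obtain ⟨m, hm⟩ := hC.depth.exists_split x x
    exact lt_irrefl _ ((hC.numLt_iff hm).1 h)

/-- Elements that agree below depth `m` and have the same number at depth `m` are equal or lie above
a common chain of depth `m`. -/
lemma eq_or_common (hC : IsCoding d E ps n num) {m : ℕ} {x y : T} (hsame : ∀ t, d t < m → (t ≤ x ↔ t ≤ y))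
    (hnum : lowNum d n num m x = lowNum d n num m y) :
    (x = y ∧ d x < m) ∨ ∃ z, z ≤ x ∧ z ≤ y ∧ d z = m := by
  have hex : ∀ {x y}, lowNum d n num m x = lowNum d n num m y → m ≤ d x →
      ∃ z, z ≤ y ∧ d z = m := by
    intro x y hxy hx
    obtain ⟨z, hzx, hz⟩ := hC.depth.exists_le x m hx
    rw [hC.lowNum_eq hzx hz] at hxy
    obtain ⟨w, -, hw⟩ := (hC.lowNum_le_iff (hC.num_lt z)).1 hxy.ge
    exact ⟨w, hw⟩
  by_cases hx : m ≤ d x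
  · obtain ⟨z', hz'y, hz'⟩ := hex hnum hx
    obtain ⟨z, hzx, hz⟩ := hC.depth.exists_le x m hx
    right
    rw [hC.lowNum_eq hzx hz, hC.lowNum_eq hz'y hz'] at hnum
    obtain ⟨w, hwz, hwz', hw⟩ := hC.num_conn z z' (hz.trans hz'.symm) (fun t ht => by
      rw [hz] at ht
      constructor
      · intro h
        exact hC.depth.le_of_depth_lt hC.tree ((hsame t ht).1 (h.trans hzx)) hz'y (by omega)
      · intro h
        exact hC.depth.le_of_depth_lt hC.tree ((hsame t ht).2 (h.trans hz'y)) hzx (by omega)) hnum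
    exact ⟨w, hwz.trans hzx, hwz'.trans hz'y, hw.trans hz⟩
  · left
    have hy : ¬ m ≤ d y := fun hy => by
      obtain ⟨z, hzx, hz⟩ := hex hnum.symm hy
      exact hx (hz ▸ hC.depth.mono hzx)
    push Not at hx hy
    exact ⟨le_antisymm ((hsame x hx).1 le_rfl) ((hsame y hy).2 le_rfl), hx⟩

lemma treeLt_trichotomous (hC : IsCoding d E ps n num) (x y : T) (hxy : ¬ TreeLt ps (numSets n num) E x y)
    (hyx : ¬ TreeLt ps (numSets n num) E y x) : x = y := by
  obtain ⟨m, hm⟩ := hC.depth.exists_split x y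
  have h1 : ¬ MeetCutLt ps E x y := fun h => hxy (Or.inl h)
  have h2 : ¬ MeetCutLt ps E y x := fun h => hyx (Or.inl h)
  have h3 : ¬ NumLt (numSets n num) E x y := fun h => hxy (Or.inr ⟨h2, h⟩)
  have h4 : ¬ NumLt (numSets n num) E y x := fun h => hyx (Or.inr ⟨h1, h⟩)
  rw [hC.numLt_iff hm] at h3
  rw [hC.numLt_iff hm.symm] at h4
  have hsame : ∀ t, d t < m → (t ≤ x ↔ t ≤ y) := by
    cases m with
    | zero => exact fun t ht => absurd ht (Nat.not_lt_zero _)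
    | succ m =>
      obtain ⟨s, hsx, hsy, hs⟩ := hm.1 m (Nat.lt_succ_self m)
      have hcut : ∀ t, E s t → (t ≤ x ↔ t ≤ y) := by
        intro t ht
        by_contra hne
        rcases hC.cut_total s x y ⟨t, ht, hne⟩ with h | h
        · exact h1 ⟨s, (hC.meet_iff hm).2 ⟨hsx, hsy, hs⟩, h⟩
        · exact h2 ⟨s, (hC.meet_iff hm.symm).2 ⟨hsy, hsx, hs⟩, h⟩
      have aux : ∀ {x y : T}, s ≤ x → s ≤ y → (∀ t, E s t → (t ≤ x ↔ t ≤ y)) →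
          ∀ t, d t < m + 1 → t ≤ x → t ≤ y := by
        intro x y hsx hsy hcut t ht htx
        rcases (show d t < m ∨ d t = m by omega) with h | h
        · exact (hC.depth.le_of_depth_lt hC.tree htx hsx (hs ▸ h)).trans hsy
        · exact (hcut t (hC.rel_of_le hsx htx (hs.trans h.symm))).1 htx
      exact fun t ht => ⟨aux hsx hsy hcut t ht, aux hsy hsx (fun t ht => (hcut t ht).symm) t ht⟩
  rcases hC.eq_or_common hsame (by omega) with h | ⟨z, hzx, hzy, hz⟩
  · exact h.1
  · exact absurd (hm.2 z hzx hzy) (by omega)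

/-- Among elements that share their first `m` chains, those that leave the last of them at the least
cut. -/
lemma exists_least_cut (hC : IsCoding d E ps n num) {m : ℕ} {S : Set T} (hS : S.Nonempty)
    (hcom : ∀ x ∈ S, ∀ y ∈ S, Common d m x y) :
    ∃ S₁ ⊆ S, S₁.Nonempty ∧
      (∀ x ∈ S₁, ∀ w ∈ S, Split d m w x →
        ¬ MeetCutLt ps E w x ∧ (¬ MeetCutLt ps E x w → w ∈ S₁)) ∧
      (∀ x ∈ S₁, ∀ y ∈ S₁, ∀ t, d t < m → t ≤ x → t ≤ y) ∧
      ∀ x ∈ S₁, ∀ w ∈ S, (∃ z, z ≤ w ∧ z ≤ x ∧ d z = m) → w ∈ S₁ := by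
  cases m with
  | zero =>
    exact ⟨S, subset_rfl, hS,
      fun x _ w hw h => ⟨fun ⟨s, hs, _⟩ => not_meet_of_split_zero h hs, fun _ => hw⟩,
      fun x _ y _ t ht => absurd ht (Nat.not_lt_zero _), fun x _ w hw _ => hw⟩
  | succ m =>
    have hequiv := hC.rel_equiv
    obtain ⟨p, hp⟩ := hS
    -- All members of `S` pass through one chain of depth `m`, so a single `s` represents it for
    -- every pair.
    obtain ⟨s, hsp, -, hs⟩ := hcom p hp p hp m (Nat.lt_succ_self m)
    have hrel : ∀ x ∈ S, ∀ t, t ≤ x → d t = m → E s t := by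
      intro x hx t htx ht
      obtain ⟨z, hzx, hzp, hz⟩ := hcom x hx p hp m (Nat.lt_succ_self m)
      exact hequiv.trans (hC.rel_of_le hsp hzp (hs.trans hz.symm))
        (hC.rel_of_le hzx htx (hz.trans ht.symm))
    have hcut : ∀ x ∈ S, ∀ y ∈ S, Split d (m + 1) x y →
        (MeetCutLt ps E x y ↔ CutLt ps E s x y) := by
      intro x hx y hy hxy
      constructor
      · rintro ⟨s', hs', h⟩
        obtain ⟨h1, -, h3⟩ := (hC.meet_iff hxy).1 hs'
        exact hC.cut_congr s' s (hequiv.symm (hrel x hx s' h1 h3)) x y h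
      · intro h
        obtain ⟨z, hzx, hzy, hz⟩ := hcom x hx y hy m (Nat.lt_succ_self m)
        exact ⟨z, (hC.meet_iff hxy).2 ⟨hzx, hzy, hz⟩,
          hC.cut_congr s z (hrel x hx z hzx hz) x y h⟩
    obtain ⟨q, hq, hqmin⟩ := (hC.cut_wf s).has_min S ⟨p, hp⟩
    refine ⟨{x | x ∈ S ∧ ∀ t, E s t → (t ≤ x ↔ t ≤ q)}, fun x hx => hx.1,
      ⟨q, hq, fun _ _ => Iff.rfl⟩, ?_, ?_, ?_⟩
    · rintro x ⟨hx, hxq⟩ w hw hwx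
      have hcongr : ∀ {a b}, (∀ t, E s t → (t ≤ a ↔ t ≤ b)) →
          (CutLt ps E s w a ↔ CutLt ps E s w b) := fun hab =>
        CutLt.congr (G := {t | E s t}) (fun t ht u hu => hequiv.trans ht hu) (hequiv.refl s)
          (fun _ _ => Iff.rfl) hab
      rw [hcut w hw x hx hwx, hcut x hx w hw hwx.symm]
      have hnot : ¬ CutLt ps E s w x := fun h => hqmin w hw ((hcongr hxq).1 h)
      refine ⟨hnot, fun hnot' => ⟨hw, fun t ht => ?_⟩⟩
      rw [← hxq t ht]
      by_contra hne
      rcases hC.cut_total s w x ⟨t, ht, hne⟩ with h | h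
      · exact hnot h
      · exact hnot' h
    · rintro x ⟨hx, hxq⟩ y ⟨hy, hyq⟩ t ht htx
      rcases (show d t < m ∨ d t = m by omega) with h | h
      · obtain ⟨z, hzx, hzy, hz⟩ := hcom x hx y hy m (Nat.lt_succ_self m)
        exact (hC.depth.le_of_depth_lt hC.tree htx hzx (hz ▸ h)).trans hzy
      · have hst := hrel x hx t htx h
        exact (hyq t hst).2 ((hxq t hst).1 htx)
    · rintro x ⟨hx, hxq⟩ w hw ⟨z, hzw, hzx, hz⟩
      refine ⟨hw, fun t ht => ?_⟩
      have htm : d t < d z := by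
        have := ((hC.rel_iff s t).1 ht).2
        omega
      rw [← hxq t ht]
      exact ⟨fun h => (hC.depth.le_of_depth_lt hC.tree h hzw htm).trans hzx,
        fun h => (hC.depth.le_of_depth_lt hC.tree h hzx htm).trans hzw⟩

/-- Among elements that share their first `m` chains, the least ones share one chain more. -/
lemma exists_initial_part (hC : IsCoding d E ps n num) {m : ℕ} {S : Set T} (hS : S.Nonempty)
    (hcom : ∀ x ∈ S, ∀ y ∈ S, Common d m x y) :
    ∃ S' ⊆ S, S'.Nonempty ∧ (S'.Subsingleton ∨ ∀ x ∈ S', ∀ y ∈ S', Common d (m + 1) x y) ∧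
      ∀ r ∈ S', ∀ w ∈ S, TreeLt ps (numSets n num) E w r → w ∈ S' := by
  obtain ⟨S₁, hS₁, hne, hcut, hsame, hshare⟩ := hC.exists_least_cut hS hcom
  obtain ⟨q, hq, hqmin⟩ := (InvImage.wf (lowNum d n num m) (wellFounded_lt (α := ℕ))).has_min S₁ hne
  have hmin : ∀ x ∈ S₁, lowNum d n num m q ≤ lowNum d n num m x :=
    fun x hx => not_lt.1 (hqmin x hx)
  refine ⟨{x | x ∈ S₁ ∧ lowNum d n num m x = lowNum d n num m q}, fun x hx => hS₁ hx.1,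
    ⟨q, hq, rfl⟩, ?_, ?_⟩
  · have hpair : ∀ x ∈ S₁, lowNum d n num m x = lowNum d n num m q → ∀ y ∈ S₁,
        lowNum d n num m y = lowNum d n num m q →
        (x = y ∧ d x < m) ∨ ∃ z, z ≤ x ∧ z ≤ y ∧ d z = m := fun x hx hxq y hy hyq =>
      hC.eq_or_common (fun t ht => ⟨hsame x hx y hy t ht, hsame y hy x hx t ht⟩)
        (hxq.trans hyq.symm)
    -- Either `q` does not reach depth `m`, and then `q` is the only point with its cut and number,
    -- or all these points share a chain of depth `m`.
    rcases hpair q hq rfl q hq rfl with ⟨-, hdq⟩ | ⟨z, hzq, -, hz⟩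
    · left
      rintro x ⟨hx, hxq⟩ y ⟨hy, hyq⟩
      have : ∀ x ∈ S₁, lowNum d n num m x = lowNum d n num m q → q = x := by
        intro x hx hxq
        rcases hpair q hq rfl x hx hxq with h | ⟨z, hzq, -, hz⟩
        · exact h.1
        · have := hC.depth.mono hzq
          omega
      exact (this x hx hxq).symm.trans (this y hy hyq)
    · right
      rintro x ⟨hx, hxq⟩ y ⟨hy, hyq⟩
      rcases hpair x hx hxq y hy hyq with ⟨-, hdx⟩ | ⟨w, hwx, hwy, hw⟩
      · rcases hpair x hx hxq q hq rfl with ⟨rfl, -⟩ | ⟨w, hwx, -, hw⟩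
        · have := hC.depth.mono hzq
          omega
        · have := hC.depth.mono hwx
          omega
      · exact hC.depth.common_of_le hwx hwy (by omega)
  · rintro r ⟨hr, hrq⟩ w hw hlt
    -- Minimality of cut and number forbids a predecessor `w` that parts from `r` at depth `m`;
    -- otherwise `w` and `r` share the chain of depth `m`, hence the cut and the number.
    by_cases hsplit : Split d m w r
    · exfalso
      obtain ⟨h1, h2⟩ := hcut r hr w hw hsplit
      obtain ⟨h3, h4⟩ := hlt.resolve_left h1
      rw [hC.numLt_iff hsplit] at h4
      have := hmin w (h2 h3)
      omega
    · have : ∃ z, z ≤ w ∧ z ≤ r ∧ d z = m := by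
        by_contra! hcon
        refine hsplit ⟨hcom w hw r (hS₁ hr), fun z hzw hzr => ?_⟩
        by_contra! hz
        obtain ⟨v, hvz, hv⟩ := hC.depth.exists_le z m hz
        exact hcon v (hvz.trans hzw) (hvz.trans hzr) hv
      refine ⟨hshare r hr w hw this, ?_⟩
      obtain ⟨z, hzw, hzr, hz⟩ := this
      rw [← hrq, hC.lowNum_eq hzw hz, hC.lowNum_eq hzr hz]

/-- Induction along the tree of chains: the initial part `S'` is a single point or moves on to a
successor chain. Whatever precedes a point of `S'` is again in `S'`, so a minimum of `S'` is one of
`S` without any appeal to transitivity. -/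
lemma exists_min_of_common (hC : IsCoding d E ps n num) {m : ℕ} (x₀ : T) (hx₀ : d x₀ = m) {S : Set T} (hS : S.Nonempty)
    (hsub : ∀ y ∈ S, ∃ z, z ≤ x₀ ∧ z ≤ y ∧ d z = m) :
    ∃ r ∈ S, ∀ w ∈ S, ¬ TreeLt ps (numSets n num) E w r := by
  induction x₀ using hC.depth.wf.induction generalizing m S with
  | _ x₀ ih =>
    have hcom : ∀ x ∈ S, ∀ y ∈ S, Common d (m + 1) x y := by
      intro x hx y hy
      obtain ⟨z, hzx₀, hzx, hz⟩ := hsub x hx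
      obtain ⟨z', hz'x₀, hz'y, hz'⟩ := hsub y hy
      rcases hC.tree.total hzx₀ hz'x₀ with h | h
      · exact hC.depth.common_of_le hzx (h.trans hz'y) (by omega)
      · exact hC.depth.common_of_le (h.trans hzx) hz'y (by omega)
    obtain ⟨S', hS', ⟨p, hp⟩, hor, hlow⟩ := hC.exists_initial_part hS hcom
    rcases hor with hss | hcom'
    · refine ⟨p, hS' hp, fun w hw h => ?_⟩
      have := hss (hlow p hp w hw h) hp
      exact hC.not_treeLt_self p (this ▸ h)
    · obtain ⟨x₁, hx₁p, -, hx₁⟩ := hcom' p hp p hp (m + 1) (Nat.lt_succ_self _)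
      obtain ⟨z, hzx₀, hzp, hz⟩ := hsub p (hS' hp)
      obtain ⟨r, hr, hrmin⟩ := ih x₁
        ⟨by omega, z, hzx₀, hC.depth.le_of_depth_lt hC.tree hzp hx₁p (by omega), by omega⟩
        hx₁ ⟨p, hp⟩ (fun y hy => by
          obtain ⟨v, hvp, hvy, hv⟩ := hcom' p hp y hy (m + 1) (Nat.lt_succ_self _)
          rcases hC.tree.total hvp hx₁p with h | h
          · exact ⟨v, h, hvy, hv⟩
          · exact ⟨x₁, le_rfl, h.trans hvy, hx₁⟩)
      exact ⟨r, hS' hr, fun w hw h => hrmin w (hlow r hr w hw h) h⟩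

/-- Transitivity is a consequence of trichotomy and well-foundedness. -/
theorem treeLt_isWellOrder (hC : IsCoding d E ps n num) : IsWellOrder T (TreeLt ps (numSets n num) E) := by
  refine { wf := WellFounded.wellFounded_iff_has_min.2 fun S hS => ?_,
           trichotomous := hC.treeLt_trichotomous }
  obtain ⟨S', hS', ⟨p, hp⟩, hor, hlow⟩ := hC.exists_initial_part (m := 0) hS
    (fun _ _ _ _ i hi => absurd hi (Nat.not_lt_zero _))
  rcases hor with hss | hcom
  · refine ⟨p, hS' hp, fun w hw h => ?_⟩
    have := hss (hlow p hp w hw h) hp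
    exact hC.not_treeLt_self p (this ▸ h)
  · obtain ⟨x₁, hx₁p, -, hx₁⟩ := hcom p hp p hp 0 Nat.one_pos
    obtain ⟨r, hr, hrmin⟩ := hC.exists_min_of_common x₁ hx₁ ⟨p, hp⟩ (fun y hy => by
      obtain ⟨v, hvp, hvy, hv⟩ := hcom p hp y hy 0 Nat.one_pos
      rcases hC.tree.total hvp hx₁p with h | h
      · exact ⟨v, h, hvy, hv⟩
      · exact ⟨x₁, le_rfl, h.trans hvy, hx₁⟩)
    exact ⟨r, hS' hr, fun w hw h => hrmin w (hlow r hr w hw h) h⟩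

end IsCoding

theorem exists_isCoding (hT : IsTree T) {n k : ℕ} (htame : TameFor T n k)
    (hbin : ¬ EmbedsBinaryTree T) :
    ∃ (d : T → ℕ) (ps : List (Set T × Set T)) (num : T → ℕ),
      IsCoding d (Mono {x | Even (d x)}) ps n num := by
  obtain ⟨d, hd⟩ := exists_depth hT hbin
  obtain ⟨num, hn1, hn2, hn3⟩ := hd.exists_num hT htame.card_le
  have hiff := hd.mono_even_iff hT
  have hequiv := hd.equivalence hT hiff
  obtain ⟨ps, h1, h2, h3, h4⟩ := exists_cutLt_wellOrder k _ hequiv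
    (fun a b h => ((hiff a b).1 h).1)
    (fun a b z h haz hzb => (hiff a z).2 ⟨Or.inl haz, le_antisymm (hd.mono haz)
      ((hd.mono hzb).trans_eq ((hiff a b).1 h).2.symm)⟩)
    (fun s => htame.hdegLE hT fun a ha b hb _ =>
      ((hiff a b).1 (hequiv.trans (hequiv.symm ha) hb)).1)
  exact ⟨d, ps, num, hT, hd, hiff, h1, h2, h3, h4, hn1, hn2, hn3⟩

end Order

end MonadicTree
namespace MonadicTree

/-! ### Monadic definability of the ordering -/

section Definability

variable {T : Type u} [PartialOrder T] {m : ℕ}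

/-- The relation `R` is defined by a monadic formula with parameters `Q`. -/
def Definable (Q : Fin m → Set T) {n : ℕ} (R : (Fin n → T) → Prop) : Prop :=
  ∃ φ : MFormula n m, ∀ v, φ.Realize v Q ↔ R v

namespace Definable

variable {Q : Fin m → Set T} {n : ℕ} {R R' : (Fin n → T) → Prop}

lemma le (i j : Fin n) : Definable Q fun v => v i ≤ v j := ⟨.le i j, fun _ => Iff.rfl⟩

lemma mem {S : Set T} (hS : ∃ j, Q j = S) (i : Fin n) : Definable Q fun v => v i ∈ S := by
  obtain ⟨j, rfl⟩ := hS
  exact ⟨.mem i j, fun _ => Iff.rfl⟩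

lemma not (h : Definable Q R) : Definable Q fun v => ¬ R v :=
  let ⟨φ, hφ⟩ := h
  ⟨.not φ, fun v => not_congr (hφ v)⟩

lemma and (h : Definable Q R) (h' : Definable Q R') : Definable Q fun v => R v ∧ R' v :=
  let ⟨φ, hφ⟩ := h
  let ⟨ψ, hψ⟩ := h'
  ⟨.and φ ψ, fun v => and_congr (hφ v) (hψ v)⟩

lemma congr (h : Definable Q R) (hR : ∀ v, R' v ↔ R v) : Definable Q R' :=
  let ⟨φ, hφ⟩ := h
  ⟨φ, fun v => (hφ v).trans (hR v).symm⟩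

lemma or (h : Definable Q R) (h' : Definable Q R') : Definable Q fun v => R v ∨ R' v :=
  (h.not.and h'.not).not.congr fun _ => or_iff_not_and_not

lemma imp (h : Definable Q R) (h' : Definable Q R') : Definable Q fun v => R v → R' v :=
  (h.not.or h').congr fun _ => imp_iff_not_or

lemma iff (h : Definable Q R) (h' : Definable Q R') : Definable Q fun v => R v ↔ R' v :=
  ((h.imp h').and (h'.imp h)).congr fun _ => iff_iff_implies_and_implies

lemma ex {R : (Fin n → T) → T → Prop}
    (h : Definable Q fun v : Fin (n + 1) → T => R (fun i => v i.castSucc) (v (Fin.last n))) :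
    Definable Q fun v => ∃ x, R v x := by
  obtain ⟨φ, hφ⟩ := h
  refine ⟨.exElem φ, fun v => exists_congr fun x => (hφ _).trans ?_⟩
  simp only [Fin.snoc_castSucc, Fin.snoc_last]

lemma all {R : (Fin n → T) → T → Prop}
    (h : Definable Q fun v : Fin (n + 1) → T => R (fun i => v i.castSucc) (v (Fin.last n))) :
    Definable Q fun v => ∀ x, R v x :=
  (Definable.ex (R := fun v x => ¬ R v x) h.not).not.congr fun _ => not_exists_not.symm

/-- The list is fixed outside the formula, so the quantifier unfolds to a finite disjunction. -/
lemma exists_mem_list {ι : Type*} {l : List ι} {R : ι → (Fin n → T) → Prop}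
    (h : ∀ a ∈ l, Definable Q (R a)) (htriv : Definable Q fun _ : Fin n → T => False) :
    Definable Q fun v => ∃ a ∈ l, R a v := by
  induction l with
  | nil => exact htriv.congr fun v => by simp
  | cons a l ih =>
    exact ((h a (by simp)).or (ih fun b hb => h b (by simp [hb]))).congr fun v => by simp

lemma false (i : Fin n) : Definable Q fun _ : Fin n → T => False :=
  ((le i i).not).congr fun v => by simp

lemma mono {c : Set T} (hc : ∃ j, Q j = c) (i j : Fin n) :
    Definable Q fun v => Mono c (v i) (v j) := by
  refine ((le _ _).or (le _ _)).and (all ?_)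
  exact (((le _ _).and (le _ _)).or ((le _ _).and (le _ _))).imp ((mem hc _).iff (mem hc _))

/-- A binary relation on `T` defined with parameters `Q`, at all places of a formula. -/
abbrev Binary (Q : Fin m → Set T) (E : T → T → Prop) : Prop :=
  ∀ (n : ℕ) (i j : Fin n), Definable Q fun v : Fin n → T => E (v i) (v j)

lemma fibreLt {E E' M : T → T → Prop} (hE : Binary Q E) (hE' : Binary Q E') (hM : Binary Q M)
    (s i j : Fin n) : Definable Q fun v => FibreLt {t | E (v s) t} E' M (v i) (v j) := by
  refine ex ?_
  refine (hE _ _ _).and ((hM _ _ _).not.and (all ?_))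
  exact (hE _ _ _).imp ((hE' _ _ _).imp (hM _ _ _))

lemma fibreLex {E E' M : T → T → Prop} {r : T → T → T → Prop} (hE : Binary Q E)
    (hE' : Binary Q E') (hM : Binary Q M)
    (hr : ∀ (n : ℕ) (s i j : Fin n), Definable Q fun v : Fin n → T => r (v s) (v i) (v j))
    (s i j : Fin n) : Definable Q fun v => FibreLex {t | E (v s) t} E' M r (v i) (v j) := by
  refine (fibreLt hE hE' hM s i j).or ((fibreLt hE hE' hM s j i).not.and (ex ?_))
  exact (hE _ _ _).and (hr _ _ _ _)

/-- Each level of the recursion refines `E` and adds quantifiers, so `E` must vary in the induction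
and be definable in every context. -/
lemma cutLt {ps : List (Set T × Set T)} (hps : ∀ p ∈ ps, (∃ j, Q j = p.1) ∧ ∃ j, Q j = p.2)
    {E : T → T → Prop} (hE : Binary Q E) (s i j : Fin n) :
    Definable Q fun v => CutLt ps E (v s) (v i) (v j) := by
  induction ps generalizing E n with
  | nil => exact ex ((hE _ _ _).and ((le _ _).not.and (le _ _)))
  | cons p ps ih =>
    obtain ⟨h1, h2⟩ := hps p (by simp)
    have hE' : Binary Q fun a b => E a b ∧ Mono p.1 a b :=
      fun n i j => (hE n i j).and (mono h1 i j)
    have hr := fun (n : ℕ) (s i j : Fin n) =>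
      ih (fun q hq => hps q (List.mem_cons_of_mem _ hq)) hE' s i j
    exact ((mem h2 s).not.and (fibreLex hE hE' (fun n i j => le j i) hr s i j)).or
      ((mem h2 s).and (fibreLex hE hE' (fun n i j => (le j i).not) hr s i j))

lemma meet {E : T → T → Prop} (hE : Binary Q E) (s i j : Fin n) :
    Definable Q fun v => Meet E (v s) (v i) (v j) :=
  (le _ _).and ((le _ _).and (all ((le _ _).imp ((le _ _).imp ((le _ _).or (hE _ _ _))))))

lemma meetCutLt {ps : List (Set T × Set T)}
    (hps : ∀ p ∈ ps, (∃ j, Q j = p.1) ∧ ∃ j, Q j = p.2) {E : T → T → Prop} (hE : Binary Q E)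
    (i j : Fin n) : Definable Q fun v => MeetCutLt ps E (v i) (v j) :=
  ex ((meet hE _ _ _).and (cutLt hps hE _ _ _))

lemma firstApart {E : T → T → Prop} (hE : Binary Q E) (s i j : Fin n) :
    Definable Q fun v => FirstApart E (v s) (v i) (v j) := by
  refine (le _ _).and ((ex ((hE _ _ _).and (le _ _))).not.and (all ((le _ _).imp ?_)))
  exact (hE _ _ _).or (ex ((hE _ _ _).and (le _ _)))

lemma numLt {Ms : List (Set T)} (hMs : ∀ M ∈ Ms, ∃ j, Q j = M) {E : T → T → Prop}
    (hE : Binary Q E) (i j : Fin n) : Definable Q fun v => NumLt Ms E (v i) (v j) := by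
  refine exists_mem_list (fun M hM => ?_) (false i)
  exact (ex ((mem (hMs M hM) _).and (firstApart hE _ _ _))).and
    (ex ((mem (hMs M hM) _).and (firstApart hE _ _ _))).not

lemma treeLt {ps : List (Set T × Set T)}
    (hps : ∀ p ∈ ps, (∃ j, Q j = p.1) ∧ ∃ j, Q j = p.2)
    {Ms : List (Set T)} (hMs : ∀ M ∈ Ms, ∃ j, Q j = M) {E : T → T → Prop}
    (hE : Binary Q E) (i j : Fin n) : Definable Q fun v => TreeLt ps Ms E (v i) (v j) :=
  (meetCutLt hps hE i j).or ((meetCutLt hps hE j i).not.and (numLt hMs hE i j))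

end Definable

end Definability

end MonadicTree

theorem lemma5p4 {T : Type u} [PartialOrder T] (hT : MonadicTree.IsTree T)
    (htame : MonadicTree.Tame T) (hbin : ¬ MonadicTree.EmbedsBinaryTree T) :
    ∃ (m : ℕ) (Q : Fin m → Set T) (φ : MonadicTree.MFormula 2 m),
      IsWellOrder T (fun x y => φ.Realize ![x, y] Q) := by
  open MonadicTree in
  obtain ⟨n, k, htame⟩ := htame
  obtain ⟨d, ps, num, hC⟩ := exists_isCoding hT htame hbin
  -- The parameters: the parity of the depth, a colouring and a direction set for each entry of
  -- `ps`, and the thresholds of the numbering.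
  let L : List (Set T) :=
    {x | Even (d x)} :: (ps.map Prod.fst ++ ps.map Prod.snd ++ numSets n num)
  have hL : ∀ S ∈ L, ∃ j, L.get j = S := fun S hS => List.mem_iff_get.1 hS
  obtain ⟨φ, hφ⟩ := Definable.treeLt (Q := L.get) (n := 2) (ps := ps) (Ms := numSets n num)
    (fun p hp => ⟨hL _ (by simp only [L, List.mem_cons, List.mem_append, List.mem_map]; grind),
      hL _ (by simp only [L, List.mem_cons, List.mem_append, List.mem_map]; grind)⟩)
    (fun M hM => hL M (by simp [L, hM]))
    (fun n i j => Definable.mono (hL {x | Even (d x)} (by simp [L])) i j) 0 1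
  refine ⟨L.length, L.get, φ, ?_⟩
  have heq : (fun x y => φ.Realize ![x, y] L.get) =
      TreeLt ps (numSets n num) (Mono {x | Even (d x)}) := by
    funext x y
    exact propext (hφ ![x, y])
  rw [heq]
  exact hC.treeLt_isWellOrder
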